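/- Let $A$ be a $C^*$-algebra. A $C^*$-correspondence over $A$ is a right Hilbert $A$-module $E$ with a left action of $A$ given by a $*$-homomorphism $\phi$ into the adjointable operators such that $\phi(A)E$ spans a dense subspace of $E$; tensor products below are internal ones. A product system $\mathbb E$ over $\mathbb N_0^2$ is given by two correspondences $E_1,E_2$ and a unitary isomorphism $t:E_2\otimes E_1\to E_1\otimes E_2$ of correspondences. An isometric representation $(\sigma,T)$ of a correspondence $E$ on a Hilbert space $\mathsf H$ consists of a nondegenerate $*$-representation $\sigma$ of $A$ on $\mathsf H$ and a linear map $T:E\to B(\mathsf H)$ with $T(\phi(a)\xi b)=\sigma(a)T(\xi)\sigma(b)$ and $T(\xi)^*T(\eta)=\sigma(\langle\xi,\eta\rangle)$ for all $a,b\in A$, $\xi,\eta\in E$. Let $\widetilde T:E\otimes_\sigma\mathsf H\to\mathsf H$, $\widetilde T(\xi\otimes h)=T(\xi)h$. The representation is fully coisometric if $\widetilde T\widetilde T^*=I_{\mathsf H}$. It is (isomorphic to an) induced representation if for some nondegenerate representation $\pi$ of $A$ on a Hilbert space $\mathsf K$ it is unitarily equivalent to the representation $a\mapsto\phi_\infty(a)\otimes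 I$, $\xi\mapsto T_\xi\otimes I$ on $\mathcal F(E)\otimes_\pi\mathsf K$, where $\mathcal F(E)=\bigoplus_{n\ge0}E^{\otimes n}$ is the Fock module, $\phi_\infty$ is its left action and $T_\xi$ are the creation operators. An isometric representation $(\sigma,T^{(1)},T^{(2)})$ of $\mathbb E$ on $\mathsf H$ consists of isometric representations $(\sigma,T^{(i)})$ of $E_i$ ($i=1,2$) such that $\widetilde T^{(2)}(I_{E_2}\otimes\widetilde T^{(1)})=\widetilde T^{(1)}(I_{E_1}\otimes\widetilde T^{(2)})(t\otimes I_{\mathsf H})$. A closed subspace of $\mathsf H$ is reducing if it and its orthogonal complement are invariant under all $\sigma(a)$, $T^{(1)}(\xi)$ and $T^{(2)}(\eta)$. Let $P^{j}_1$ be the orthogonal projection onto the range of $\widetilde T^{(j)}$ and, for $\{i,j\}=\{1,2\}$, let $$\mathsf K^{(j)}=\{h\in\mathsf H:\ P^{j}_1T^{(i)}(\xi_1)\cdots T^{(i)}(\xi_l)h=0\ \text{ for all } l\ge0,\ \xi_1,\dots,\xi_l\in E_i\},$$ a closed subspace that reduces $\sigma(A)$ and is invariant under all $T^{(i)}(\xi)$.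 The representation is weakly bi-induced if each of $(\sigma,T^{(1)}\otimes T^{(2)})$, $(\sigma,T^{(1)})|_{\mathsf K^{(2)}}$ and $(\sigma,T^{(2)})|_{\mathsf K^{(1)}}$ is isomorphic to an induced representation (of $E_1\otimes E_2$, $E_1$ and $E_2$ respectively), where $(T^{(1)}\otimes T^{(2)})(\xi\otimes\eta)=T^{(1)}(\xi)T^{(2)}(\eta)$. **Theorem.** Let $(\sigma,T^{(1)},T^{(2)})$ be an isometric representation of a product system $\mathbb E$ over $\mathbb N_0^2$ on a Hilbert space $\mathsf H$. Then $\mathsf H$ has a unique orthogonal decomposition into four closed subspaces $$\mathsf H=\mathsf H_\emptyset\oplus\mathsf H_1\oplus\mathsf H_2\oplus\mathsf H_{wi}$$ such that 1. each of the four subspaces is reducing for $(\sigma,T^{(1)},T^{(2)})$; 2. $(\sigma,T^{(1)})$ is fully coisometric when restricted to $\mathsf H_\emptyset$ or to $\mathsf H_2$, and $(\sigma,T^{(2)})$ is fully coisometric when restricted to $\mathsf H_\emptyset$ or to $\mathsf H_1$; 3. $(\sigma,T^{(1)})|_{\mathsf H_1}$ and $(\sigma,T^{(2)})|_{\mathsf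 H_2}$ are isomorphic to induced representations (of $E_1$ and $E_2$ respectively); 4. the restriction $(\sigma,T^{(1)},T^{(2)})|_{\mathsf H_{wi}}$ is weakly bi-induced. -/

import Mathlib

open scoped InnerProductSpace

universe u v w

noncomputable section

namespace Wold

section Correspondences

/-- A `C*`-correspondence over the (not necessarily unital) `C*`-algebra `A`: a right Hilbert
`A`-module with an essential left action of `A` by adjointable operators.

Mathlib's `CStarModule B E` asks for `⟪x, b • y⟫ = b * ⟪x, y⟫`; with `B = Aᵐᵒᵖ` this is exactly a right
Hilbert `A`-module, where `x · a` is `MulOpposite.op a • x` and the `A`-valued inner product is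
`unop ⟪x, y⟫`. -/
structure Correspondence (A : Type u) [NonUnitalCStarAlgebra A] [PartialOrder A]
    [StarOrderedRing A] where
  carrier : Type v
  [normedAddCommGroup : NormedAddCommGroup carrier]
  [normedSpace : NormedSpace ℂ carrier]
  [completeSpace : CompleteSpace carrier]
  [rightSMul : SMul Aᵐᵒᵖ carrier]
  [cstarModule : CStarModule Aᵐᵒᵖ carrier]
  /-- the left action `φ` -/
  lact : A →ₙₐ[ℂ] (carrier →L[ℂ] carrier)
  /-- `φ (a)` is adjointable with adjoint `φ (a*)` -/
  lact_adjoint : ∀ (a : A) (x y : carrier),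
    inner Aᵐᵒᵖ (lact a x) y = inner Aᵐᵒᵖ x (lact (star a) y)
  /-- the closed linear span of `φ (A) E` is `E` -/
  essential : (Submodule.span ℂ {z : carrier | ∃ a x, lact a x = z}).topologicalClosure = ⊤

attribute [instance] Correspondence.normedAddCommGroup Correspondence.normedSpace
  Correspondence.completeSpace Correspondence.rightSMul Correspondence.cstarModule

variable {A : Type u} [NonUnitalCStarAlgebra A] [PartialOrder A] [StarOrderedRing A]

instance : CoeSort (Correspondence.{u, v} A) (Type v) := ⟨Correspondence.carrier⟩

namespace Correspondence

/-- The `A`-valued inner product, conjugate linear in the first variable. -/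
def ip (E : Correspondence.{u, v} A) (x y : E) : A := MulOpposite.unop (inner Aᵐᵒᵖ x y)

/-- The right action `x · a`. -/
def ract (E : Correspondence.{u, v} A) (x : E) (a : A) : E := MulOpposite.op a • x

/-- The internal tensor product `E ⊗ F` of two correspondences (balanced over `A`): a
correspondence with a bilinear map from `E × F` whose values span a dense subspace and satisfy
`⟨x ⊗ y, x' ⊗ y'⟩ = ⟨y, φ(⟨x, x'⟩) y'⟩`. This determines it up to a unique isomorphism. -/
structure TensorProduct (E F : Correspondence.{u, v} A) where
  obj : Correspondence.{u, v} A
  tmul : E →ₗ[ℂ] F →ₗ[ℂ] obj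
  lact_tmul : ∀ (a : A) (x : E) (y : F), obj.lact a (tmul x y) = tmul (E.lact a x) y
  ract_tmul : ∀ (a : A) (x : E) (y : F), obj.ract (tmul x y) a = tmul x (F.ract y a)
  ip_tmul : ∀ (x x' : E) (y y' : F),
    obj.ip (tmul x y) (tmul x' y') = F.ip y (F.lact (E.ip x x') y')
  dense : (Submodule.span ℂ {z : obj | ∃ x y, tmul x y = z}).topologicalClosure = ⊤

/-- A unitary isomorphism of correspondences. -/
structure Unitary (E F : Correspondence.{u, v} A) extends E ≃ₗ[ℂ] F where
  map_lact : ∀ (a : A) (x : E), toLinearEquiv (E.lact a x) = F.lact a (toLinearEquiv x)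
  map_ract : ∀ (a : A) (x : E), toLinearEquiv (E.ract x a) = F.ract (toLinearEquiv x) a
  map_ip : ∀ x y : E, F.ip (toLinearEquiv x) (toLinearEquiv y) = E.ip x y

lemma continuous_ip (E : Correspondence.{u, v} A) : Continuous fun p : E × E => E.ip p.1 p.2 :=
  MulOpposite.continuous_unop.comp (CStarModule.continuous_inner (A := Aᵐᵒᵖ) (E := E))

end Correspondence

variable (A) in
/-- A product system of `C*`-correspondences over `ℕ₀²`: two correspondences `E₁`, `E₂` together
with a unitary isomorphism `t : E₂ ⊗ E₁ → E₁ ⊗ E₂`. -/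
structure ProductSystem where
  E₁ : Correspondence.{u, v} A
  E₂ : Correspondence.{u, v} A
  prod₁₂ : E₁.TensorProduct E₂
  prod₂₁ : E₂.TensorProduct E₁
  t : prod₂₁.obj.Unitary prod₁₂.obj

end Correspondences

section Representations

variable {A : Type u} [NonUnitalCStarAlgebra A] [PartialOrder A] [StarOrderedRing A]
variable {H : Type w} [NormedAddCommGroup H] [InnerProductSpace ℂ H] [CompleteSpace H]

/-- The `*`-representation `σ` is nondegenerate: `σ(A)H` spans a dense subspace of `H`. -/
def Nondegenerate (σ : A →⋆ₙₐ[ℂ] (H →L[ℂ] H)) : Prop :=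
  (Submodule.span ℂ {v : H | ∃ a h, σ a h = v}).topologicalClosure = ⊤

/-- `τ : E × H → X` exhibits the Hilbert space `X` as the internal tensor product `E ⊗_σ H`:
`⟨ξ ⊗ h, η ⊗ k⟩ = ⟨h, σ(⟨ξ, η⟩) k⟩`, and the simple tensors span a dense subspace. -/
structure IsInteriorTensor {E : Correspondence.{u, v} A} (σ : A →⋆ₙₐ[ℂ] (H →L[ℂ] H))
    {X : Type w} [NormedAddCommGroup X] [InnerProductSpace ℂ X] [CompleteSpace X]
    (τ : E →ₗ[ℂ] H →ₗ[ℂ] X) : Prop where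
  inner_tmul : ∀ (x y : E) (h k : H), ⟪τ x h, τ y k⟫_ℂ = ⟪h, σ (E.ip x y) k⟫_ℂ
  dense : (Submodule.span ℂ {z : X | ∃ x h, τ x h = z}).topologicalClosure = ⊤

variable (H) in
/-- An isometric (covariant) representation `(σ, T)` of the correspondence `E` on the Hilbert space
`H`. Complete contractivity of `T` is automatic: the matrix `[T(ξᵢⱼ)]` satisfies
`[T(ξᵢⱼ)]* [T(ξᵢⱼ)] = [σ(∑ₖ ⟨ξₖᵢ, ξₖⱼ⟩)]`, and `σ` is completely contractive. -/
structure IsometricRep (E : Correspondence.{u, v} A) where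
  σ : A →⋆ₙₐ[ℂ] (H →L[ℂ] H)
  nondegenerate : Nondegenerate σ
  T : E →ₗ[ℂ] (H →L[ℂ] H)
  map_lact : ∀ (a : A) (ξ : E), T (E.lact a ξ) = σ a * T ξ
  map_ract : ∀ (a : A) (ξ : E), T (E.ract ξ a) = T ξ * σ a
  isometric : ∀ ξ η : E, star (T ξ) * T η = σ (E.ip ξ η)

namespace IsometricRep

variable {E F : Correspondence.{u, v} A}

lemma inner_T (S : IsometricRep H E) (ξ η : E) (h k : H) :
    ⟪S.T ξ h, S.T η k⟫_ℂ = ⟪h, S.σ (E.ip ξ η) k⟫_ℂ := by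
  rw [← S.isometric, mul_apply_eq_comp, ContinuousLinearMap.star_eq_adjoint,
    ContinuousLinearMap.adjoint_inner_right]

/-- The closed linear span of the vectors `T(ξ)h`, i.e. the range of `T̃`. -/
def rangeClosure (S : IsometricRep H E) : Submodule ℂ H :=
  (Submodule.span ℂ {v : H | ∃ ξ h, S.T ξ h = v}).topologicalClosure

instance (S : IsometricRep H E) : CompleteSpace S.rangeClosure :=
  (Submodule.isClosed_topologicalClosure _).completeSpace_coe

/-- The orthogonal projection `P₁` onto the range of `T̃`. -/
def rangeProj (S : IsometricRep H E) : H →L[ℂ] H := S.rangeClosure.starProjection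

/-- `(σ, T)` is fully coisometric: `T̃ T̃* = I`, where `T̃ : E ⊗_σ H → H`, `T̃ (ξ ⊗ h) = T(ξ) h`.
The space `E ⊗_σ H` is unique up to a unitary matching the simple tensors, so that the choice of a
model for it is immaterial. -/
def IsFullyCoisometric (S : IsometricRep H E) : Prop :=
  ∃ (X : Type w) (_ : NormedAddCommGroup X) (_ : InnerProductSpace ℂ X) (_ : CompleteSpace X)
    (τ : E →ₗ[ℂ] H →ₗ[ℂ] X) (T' : X →L[ℂ] H),
    IsInteriorTensor S.σ τ ∧ (∀ ξ h, T' (τ ξ h) = S.T ξ h) ∧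
      T' ∘L (ContinuousLinearMap.adjoint T') = ContinuousLinearMap.id ℂ H

end IsometricRep

/-- The Hilbert spaces `X n = E^{⊗ n} ⊗_π K` (`X 0 = K`, `X (n + 1) = E ⊗ X n`) whose direct sum is
`𝓕(E) ⊗_π K` for the Fock module `𝓕(E) = ⨁ₙ E^{⊗ n}`, with the actions `σ n` of `A` on them that come
from the left action on the leftmost tensor factor. -/
structure FockTower (E : Correspondence.{u, v} A) {K : Type w} [NormedAddCommGroup K]
    [InnerProductSpace ℂ K] [CompleteSpace K] (π : A →⋆ₙₐ[ℂ] (K →L[ℂ] K)) where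
  X : ℕ → Type w
  [normedAddCommGroup : ∀ n, NormedAddCommGroup (X n)]
  [innerProductSpace : ∀ n, InnerProductSpace ℂ (X n)]
  [completeSpace : ∀ n, CompleteSpace (X n)]
  σ : ∀ n, A →⋆ₙₐ[ℂ] (X n →L[ℂ] X n)
  base : X 0 ≃ₗᵢ[ℂ] K
  base_σ : ∀ a x, base (σ 0 a x) = π a (base x)
  tmul : ∀ n, E →ₗ[ℂ] X n →ₗ[ℂ] X (n + 1)
  isInteriorTensor : ∀ n, IsInteriorTensor (σ n) (tmul n)
  σ_tmul : ∀ n a ξ x, σ (n + 1) a (tmul n ξ x) = tmul n (E.lact a ξ) x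

attribute [instance] FockTower.normedAddCommGroup FockTower.innerProductSpace
  FockTower.completeSpace

namespace IsometricRep

variable {E F : Correspondence.{u, v} A}

/-- `(σ, T)` is isomorphic to an induced representation: for some nondegenerate representation `π` of
`A` on a Hilbert space `K` there is a unitary `U` from `H` onto `𝓕(E) ⊗_π K = ⨁ₙ E^{⊗ n} ⊗_π K`
carrying `σ(a)` to `φ_∞(a) ⊗ I` and `T(ξ)` to the creation operator
`T_ξ ⊗ I : (xₙ)ₙ ↦ (0, ξ ⊗ x₀, ξ ⊗ x₁, …)`. -/
def IsInduced (S : IsometricRep H E) : Prop :=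
  ∃ (K : Type w) (_ : NormedAddCommGroup K) (_ : InnerProductSpace ℂ K) (_ : CompleteSpace K)
    (π : A →⋆ₙₐ[ℂ] (K →L[ℂ] K)) (Φ : FockTower E π) (U : H ≃ₗᵢ[ℂ] lp Φ.X 2),
    Nondegenerate π ∧
      (∀ a h n, U (S.σ a h) n = Φ.σ n a (U h n)) ∧
      (∀ ξ h, U (S.T ξ h) 0 = 0) ∧
      (∀ ξ h n, U (S.T ξ h) (n + 1) = Φ.tmul n ξ (U h n))

/-! ### The representation `(σ, T ⊗ S)` of `E ⊗ F` -/

section Tensor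

variable (S : IsometricRep H E) (T : IsometricRep H F) (P : E.TensorProduct F)

/-- `x ⊗ y ↦ S(x) T(y)` on the algebraic tensor product. -/
def algT : TensorProduct ℂ E F →ₗ[ℂ] (H →L[ℂ] H) :=
  TensorProduct.lift ((LinearMap.mul ℂ (H →L[ℂ] H)).compl₁₂ S.T T.T)

/-- The canonical map of the algebraic tensor product into `E ⊗ F`. -/
def algMap : TensorProduct ℂ E F →ₗ[ℂ] P.obj := TensorProduct.lift P.tmul

/-- The continuous linear extension to `E ⊗ F` of `x ⊗ y ↦ S(x) T(y)`. -/
def tensorT : P.obj →L[ℂ] (H →L[ℂ] H) := (algT S T).extendOfNorm (algMap P)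

lemma denseRange_algMap : DenseRange (algMap P) := by
  have h := P.dense
  have hr : LinearMap.range (algMap P) = Submodule.span ℂ {z | ∃ x y, P.tmul x y = z} := by
    rw [LinearMap.range_eq_map, ← TensorProduct.span_tmul_eq_top, Submodule.map_span]
    congr 1
    ext z
    constructor
    · rintro ⟨_, ⟨x, y, rfl⟩, rfl⟩
      exact ⟨x, y, by simp [algMap]⟩
    · rintro ⟨x, y, rfl⟩
      exact ⟨_, ⟨x, y, rfl⟩, by simp [algMap]⟩
  rw [← hr] at h
  have := (Submodule.dense_iff_topologicalClosure_eq_top).2 h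
  simpa only [DenseRange, LinearMap.coe_range] using this

variable {S T} in
lemma star_algT_mul (hσ : S.σ = T.σ) (p q : TensorProduct ℂ E F) :
    star (algT S T p) * algT S T q = S.σ (P.obj.ip (algMap P p) (algMap P q)) := by
  induction p using TensorProduct.induction_on with
  | zero => simp [Correspondence.ip]
  | add p p' hp hp' => simp [Correspondence.ip, add_mul, map_add] at hp hp' ⊢; rw [hp, hp']
  | tmul x y =>
    induction q using TensorProduct.induction_on with
    | zero => simp [Correspondence.ip]
    | add p p' hp hp' => simp [Correspondence.ip, mul_add, map_add] at hp hp' ⊢; rw [hp, hp']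
    | tmul x' y' =>
      have h1 : star (S.T x * T.T y) * (S.T x' * T.T y')
          = star (T.T y) * ((star (S.T x) * S.T x') * T.T y') := by
        simp only [star_mul, mul_assoc]
      simp only [algT, algMap, TensorProduct.lift.tmul, LinearMap.compl₁₂_apply,
        LinearMap.mul_apply', P.ip_tmul]
      rw [h1, S.isometric, hσ, ← T.map_lact, T.isometric]

variable {S T} in
lemma norm_algT_le (hσ : S.σ = T.σ) (p : TensorProduct ℂ E F) :
    ‖algT S T p‖ ≤ 1 * ‖algMap P p‖ := by
  have h1 : ‖algT S T p‖ * ‖algT S T p‖ ≤ ‖algMap P p‖ * ‖algMap P p‖ := by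
    rw [← CStarRing.norm_star_mul_self, star_algT_mul P hσ, ← sq (‖algMap P p‖),
      CStarModule.norm_sq_eq (A := Aᵐᵒᵖ)]
    exact (NonUnitalStarAlgHom.norm_apply_le _ _)
  rw [one_mul]
  exact abs_le_of_sq_le_sq' (by nlinarith) (norm_nonneg _) |>.2

variable {S T} in
lemma tensorT_algMap (hσ : S.σ = T.σ) (p : TensorProduct ℂ E F) :
    tensorT S T P (algMap P p) = algT S T p :=
  LinearMap.extendOfNorm_eq (denseRange_algMap P) ⟨1, norm_algT_le P hσ⟩ p

variable {S T} in
lemma tensorT_tmul (hσ : S.σ = T.σ) (x : E) (y : F) :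
    tensorT S T P (P.tmul x y) = S.T x * T.T y := by
  have := tensorT_algMap P hσ (x ⊗ₜ[ℂ] y)
  simpa [algMap, algT] using this

variable {S T} in
lemma star_tensorT_mul (hσ : S.σ = T.σ) (z w : P.obj) :
    star (tensorT S T P z) * tensorT S T P w = S.σ (P.obj.ip z w) := by
  have hc : Continuous S.σ := map_continuous S.σ
  refine (denseRange_algMap P).induction_on₂ (p := fun z w =>
    star (tensorT S T P z) * tensorT S T P w = S.σ (P.obj.ip z w)) ?_ ?_ z w
  · refine isClosed_eq ?_ (hc.comp P.obj.continuous_ip)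
    fun_prop
  · intro p q
    rw [tensorT_algMap P hσ, tensorT_algMap P hσ, star_algT_mul P hσ]

/-- Two continuous linear maps on `E ⊗ F` that agree on the simple tensors are equal. -/
lemma ext_tmul {G : Type*} [NormedAddCommGroup G] [NormedSpace ℂ G] {f g : P.obj →L[ℂ] G}
    (h : ∀ x y, f (P.tmul x y) = g (P.tmul x y)) : f = g := by
  refine ContinuousLinearMap.ext_on (s := {z | ∃ x y, P.tmul x y = z})
    ((Submodule.dense_iff_topologicalClosure_eq_top).2 P.dense) ?_
  rintro _ ⟨x, y, rfl⟩
  exact h x y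

/-- The representation `(σ, S ⊗ T)` of `E ⊗ F`, given by `x ⊗ y ↦ S(x) T(y)`. -/
def tensor (hσ : S.σ = T.σ) : IsometricRep H P.obj where
  σ := S.σ
  nondegenerate := S.nondegenerate
  T := (tensorT S T P).toLinearMap
  map_lact a z := by
    have : (tensorT S T P) ∘L (P.obj.lact a)
        = (ContinuousLinearMap.mul ℂ (H →L[ℂ] H) (S.σ a)) ∘L (tensorT S T P) := by
      refine ext_tmul P fun x y => ?_
      simp only [ContinuousLinearMap.comp_apply, P.lact_tmul, tensorT_tmul P hσ, S.map_lact,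
        ContinuousLinearMap.mul_apply', mul_assoc]
    exact congrArg (fun f => f z) this
  map_ract a z := by
    have h1 : ∀ x, P.obj.ip x (P.obj.ract z a) = P.obj.ip x z * a := fun x => by
      simp [Correspondence.ip, Correspondence.ract]
    have h2 : ∀ x, P.obj.ip (P.obj.ract z a) x = star a * P.obj.ip z x := fun x => by
      simp [Correspondence.ip, Correspondence.ract]
    rw [← sub_eq_zero, ← CStarRing.star_mul_self_eq_zero_iff]
    simp only [ContinuousLinearMap.coe_coe, star_sub, star_mul, sub_mul, mul_sub]
    have e : ∀ p q : P.obj, star (tensorT S T P p) * tensorT S T P q = _ :=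
      star_tensorT_mul P hσ
    rw [← mul_assoc (star (tensorT S T P _)), mul_assoc (star (S.σ a)), mul_assoc (star (S.σ a)),
      ← mul_assoc (star (tensorT S T P z)), e, e, e, e, h1, h2, h1]
    simp [map_mul, map_star, mul_assoc]
  isometric z w := star_tensorT_mul P hσ z w

end Tensor

/-! ### Restrictions -/

/-- A closed subspace that reduces `σ(A)` and is invariant under all the operators `T(ξ)`.
Invariance under `σ(A)` is enough for reducing it, as `σ(A)` is closed under adjoints. -/
structure InvariantSubspace (S : IsometricRep H E) where
  toSubmodule : Submodule ℂ H
  isClosed : IsClosed (toSubmodule : Set H)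
  map_σ : ∀ a, ∀ h ∈ toSubmodule, S.σ a h ∈ toSubmodule
  map_T : ∀ ξ, ∀ h ∈ toSubmodule, S.T ξ h ∈ toSubmodule

namespace InvariantSubspace

variable {S : IsometricRep H E} (K : InvariantSubspace S)

instance : CompleteSpace K.toSubmodule := K.isClosed.completeSpace_coe

/-- The restriction of an operator to an invariant subspace. -/
def restrictOp (K : Submodule ℂ H) (B : H →L[ℂ] H) (hB : ∀ h ∈ K, B h ∈ K) : K →L[ℂ] K :=
  (B ∘L K.subtypeL).codRestrict K fun h => hB h h.2

@[simp] lemma coe_restrictOp (K : Submodule ℂ H) (B : H →L[ℂ] H) (hB : ∀ h ∈ K, B h ∈ K) (h : K) :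
    (restrictOp K B hB h : H) = B h := rfl

/-- The restriction `σ|_K`. -/
def restrictσ : A →⋆ₙₐ[ℂ] (K.toSubmodule →L[ℂ] K.toSubmodule) where
  toFun a := restrictOp K.toSubmodule (S.σ a) (K.map_σ a)
  map_smul' c a := by ext h; simp
  map_zero' := by ext h; simp
  map_add' a b := by ext h; simp
  map_mul' a b := by ext h; simp
  map_star' a := by
    rw [ContinuousLinearMap.star_eq_adjoint, ContinuousLinearMap.eq_adjoint_iff]
    intro x y
    simp only [Submodule.coe_inner, coe_restrictOp, map_star, ContinuousLinearMap.star_eq_adjoint,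
      ContinuousLinearMap.adjoint_inner_left]

@[simp] lemma coe_restrictσ (a : A) (h : K.toSubmodule) :
    (K.restrictσ a h : H) = S.σ a h := rfl

lemma nondegenerate_restrictσ : Nondegenerate K.restrictσ := by
  rw [Nondegenerate, Submodule.topologicalClosure_eq_top_iff, Submodule.eq_bot_iff]
  intro x hx
  have hσ : ∀ a, S.σ a x = 0 := by
    intro a
    have h1 : K.restrictσ a x = 0 := by
      rw [← inner_self_eq_zero (𝕜 := ℂ)]
      have := (Submodule.mem_orthogonal _ _).1 hx (K.restrictσ (star a) (K.restrictσ a x))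
        (Submodule.subset_span ⟨_, _, rfl⟩)
      rwa [map_star, ContinuousLinearMap.star_eq_adjoint,
        ContinuousLinearMap.adjoint_inner_left] at this
    exact congrArg Subtype.val h1
  have hd := S.nondegenerate
  rw [Nondegenerate, Submodule.topologicalClosure_eq_top_iff, Submodule.eq_bot_iff] at hd
  refine Subtype.ext (hd x ?_)
  refine (Submodule.mem_orthogonal _ _).2 fun u hu => ?_
  induction hu using Submodule.span_induction with
  | mem u hu =>
    obtain ⟨a, h, rfl⟩ := hu
    rw [← star_star a, map_star, ContinuousLinearMap.star_eq_adjoint,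
      ContinuousLinearMap.adjoint_inner_left, hσ, inner_zero_right]
  | zero => simp
  | add u v _ _ hu hv => rw [inner_add_left, hu, hv, add_zero]
  | smul c u _ hu => rw [inner_smul_left, hu, mul_zero]

end InvariantSubspace

/-- The restriction `(σ, T)|_K`. -/
def restrict (S : IsometricRep H E) (K : InvariantSubspace S) :
    IsometricRep K.toSubmodule E where
  σ := K.restrictσ
  nondegenerate := K.nondegenerate_restrictσ
  T :=
    { toFun := fun ξ => InvariantSubspace.restrictOp K.toSubmodule (S.T ξ) (K.map_T ξ)
      map_add' := fun ξ η => by ext h; simp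
      map_smul' := fun c ξ => by ext h; simp }
  map_lact a ξ := by ext h; simp [S.map_lact]
  map_ract a ξ := by ext h; simp [S.map_ract]
  isometric ξ η := by
    ext1 h
    refine ext_inner_left ℂ fun k => ?_
    rw [mul_apply_eq_comp, ContinuousLinearMap.star_eq_adjoint,
      ContinuousLinearMap.adjoint_inner_right]
    simpa using S.inner_T ξ η k h

@[simp] lemma coe_restrict_T (S : IsometricRep H E) (K : InvariantSubspace S) (ξ : E)
    (h : K.toSubmodule) : ((S.restrict K).T ξ h : H) = S.T ξ h := rfl

/-! ### The subspaces `K⁽ʲ⁾` -/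

section Wandering

variable (S : IsometricRep H E) (T : IsometricRep H F)

lemma rangeProj_eq_zero_iff (h : H) : S.rangeProj h = 0 ↔ h ∈ S.rangeClosureᗮ :=
  Submodule.starProjection_apply_eq_zero_iff _

lemma σ_mem_rangeClosure (a : A) {h : H} (hh : h ∈ S.rangeClosure) :
    S.σ a h ∈ S.rangeClosure := by
  refine map_mem_closure (S.σ a).continuous hh fun x hx => ?_
  induction hx using Submodule.span_induction with
  | mem u hu =>
    obtain ⟨ξ, k, rfl⟩ := hu
    exact Submodule.subset_span ⟨E.lact a ξ, k, by rw [S.map_lact, mul_apply_eq_comp]⟩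
  | zero => simp
  | add u v _ _ hu hv => rw [map_add]; exact Submodule.add_mem _ hu hv
  | smul c u _ hu => rw [map_smul]; exact Submodule.smul_mem _ c hu

lemma rangeProj_σ_eq_zero (a : A) {h : H} (hh : S.rangeProj h = 0) :
    S.rangeProj (S.σ a h) = 0 := by
  rw [rangeProj_eq_zero_iff] at hh ⊢
  refine (Submodule.mem_orthogonal _ _).2 fun u hu => ?_
  rw [← star_star a, map_star, ContinuousLinearMap.star_eq_adjoint,
    ContinuousLinearMap.adjoint_inner_right]
  exact (Submodule.mem_orthogonal _ _).1 hh _ (S.σ_mem_rangeClosure _ hu)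

/-- The set of all `h` such that `P₁ T̃ₗ(ξ ⊗ h) = 0` for all `l ≥ 0` and `ξ ∈ F^{⊗ l}`, where `P₁` is the
projection onto the range of `S̃`. By linearity and continuity only `ξ = ξ₁ ⊗ ⋯ ⊗ ξₗ` are needed,
and `T̃ₗ(ξ₁ ⊗ ⋯ ⊗ ξₗ ⊗ h) = T(ξ₁) ⋯ T(ξₗ) h`. It is closed, reduces `σ(A)` and is invariant under
all `T(ξ)`. -/
def wandering (hσ : S.σ = T.σ) : InvariantSubspace T where
  toSubmodule :=
    { carrier := {h | ∀ l : List F, S.rangeProj ((l.map T.T).prod h) = 0}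
      add_mem' := fun {x y} hx hy l => by rw [map_add, map_add, hx l, hy l, add_zero]
      zero_mem' := fun l => by rw [map_zero, map_zero]
      smul_mem' := fun c x hx l => by rw [map_smul, map_smul, hx l, smul_zero] }
  isClosed := by
    change IsClosed {h | ∀ l : List F, S.rangeProj ((l.map T.T).prod h) = 0}
    rw [Set.ofPred_forall]
    exact isClosed_iInter fun l => isClosed_eq (by fun_prop) continuous_const
  map_σ a h hh l := by
    rcases List.eq_nil_or_concat l with rfl | ⟨l', ξ, rfl⟩
    · have := S.rangeProj_σ_eq_zero a (by simpa using hh [])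
      rw [hσ] at this
      simpa using this
    · have := hh (l' ++ [F.ract ξ a])
      simpa [T.map_ract, mul_assoc] using this
  map_T ξ h hh l := by
    have := hh (l ++ [ξ])
    simpa using this

end Wandering

end IsometricRep

/-! ### Representations of product systems over `ℕ₀²` -/

namespace ProductSystem

variable (H) in
/-- An isometric representation `(σ, T⁽¹⁾, T⁽²⁾)` of the product system on `H`: isometric
representations of `E₁` and `E₂` with the same `σ` such that
`T̃⁽²⁾ (I ⊗ T̃⁽¹⁾) = T̃⁽¹⁾ (I ⊗ T̃⁽²⁾) (t ⊗ I)`. -/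
structure IsometricRep (𝔼 : ProductSystem.{u, v} A) where
  fst : Wold.IsometricRep H 𝔼.E₁
  snd : Wold.IsometricRep H 𝔼.E₂
  σ_eq : fst.σ = snd.σ
  comm : ∀ z : 𝔼.prod₂₁.obj,
    (snd.tensor fst 𝔼.prod₂₁ σ_eq.symm).T z =
      (fst.tensor snd 𝔼.prod₁₂ σ_eq).T (𝔼.t.toLinearEquiv z)

namespace IsometricRep

variable {𝔼 : ProductSystem.{u, v} A}

/-- The representation `(σ, T⁽¹⁾ ⊗ T⁽²⁾)` of `E₁ ⊗ E₂`. -/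
def prod (V : 𝔼.IsometricRep H) : Wold.IsometricRep H 𝔼.prod₁₂.obj :=
  V.fst.tensor V.snd 𝔼.prod₁₂ V.σ_eq

/-- A (closed) reducing subspace of `(σ, T⁽¹⁾, T⁽²⁾)`. -/
@[ext]
structure ReducingSubspace (V : 𝔼.IsometricRep H) where
  toSubmodule : Submodule ℂ H
  isClosed : IsClosed (toSubmodule : Set H)
  map_σ : ∀ a, ∀ h ∈ toSubmodule, V.fst.σ a h ∈ toSubmodule
  map_fst : ∀ ξ, ∀ h ∈ toSubmodule, V.fst.T ξ h ∈ toSubmodule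
  map_snd : ∀ ξ, ∀ h ∈ toSubmodule, V.snd.T ξ h ∈ toSubmodule
  map_σ_orthogonal : ∀ a, ∀ h ∈ toSubmoduleᗮ, V.fst.σ a h ∈ toSubmoduleᗮ
  map_fst_orthogonal : ∀ ξ, ∀ h ∈ toSubmoduleᗮ, V.fst.T ξ h ∈ toSubmoduleᗮ
  map_snd_orthogonal : ∀ ξ, ∀ h ∈ toSubmoduleᗮ, V.snd.T ξ h ∈ toSubmoduleᗮ

namespace ReducingSubspace

variable {V : 𝔼.IsometricRep H} (R : ReducingSubspace V)

instance : CompleteSpace R.toSubmodule := R.isClosed.completeSpace_coe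

/-- A reducing subspace, as an invariant subspace of `(σ, T⁽¹⁾)`. -/
def fst : V.fst.InvariantSubspace := ⟨R.toSubmodule, R.isClosed, R.map_σ, R.map_fst⟩

/-- A reducing subspace, as an invariant subspace of `(σ, T⁽²⁾)`. -/
def snd : V.snd.InvariantSubspace :=
  ⟨R.toSubmodule, R.isClosed, fun a => V.σ_eq ▸ R.map_σ a, R.map_snd⟩

end ReducingSubspace

lemma restrict_tensor_T {E F : Correspondence.{u, v} A} (S : Wold.IsometricRep H E)
    (T : Wold.IsometricRep H F) (P : E.TensorProduct F) (hσ : S.σ = T.σ)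
    (K : Submodule ℂ H) (hK : IsClosed (K : Set H)) (h1 : ∀ a, ∀ h ∈ K, S.σ a h ∈ K)
    (h1' : ∀ a, ∀ h ∈ K, T.σ a h ∈ K)
    (h2 : ∀ ξ, ∀ h ∈ K, S.T ξ h ∈ K) (h3 : ∀ ξ, ∀ h ∈ K, T.T ξ h ∈ K)
    (hσ' : (S.restrict ⟨K, hK, h1, h2⟩).σ = (T.restrict ⟨K, hK, h1', h3⟩).σ)
    (z : P.obj) (h : K) :
    (((S.restrict ⟨K, hK, h1, h2⟩).tensor (T.restrict ⟨K, hK, h1', h3⟩) P hσ').T z h : H) =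
      (S.tensor T P hσ).T z h := by
  have : CompleteSpace K := hK.completeSpace_coe
  have := IsometricRep.ext_tmul P
    (f := K.subtypeL ∘L (ContinuousLinearMap.apply ℂ K h) ∘L
      (Wold.IsometricRep.tensorT (S.restrict ⟨K, hK, h1, h2⟩) (T.restrict ⟨K, hK, h1', h3⟩) P))
    (g := (ContinuousLinearMap.apply ℂ H (h : H)) ∘L (Wold.IsometricRep.tensorT S T P))
    (fun x y => by
      have e1 := Wold.IsometricRep.tensorT_tmul P hσ x y
      have e2 := Wold.IsometricRep.tensorT_tmul P hσ' x y
      simp only [ContinuousLinearMap.comp_apply, ContinuousLinearMap.apply_apply]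
      rw [e1]
      erw [e2]
      rfl)
  exact congrArg (fun f => f z) this

/-- The restriction (summand) `(σ, T⁽¹⁾, T⁽²⁾)|_R` of the representation to a reducing subspace. -/
def restrict (V : 𝔼.IsometricRep H) (R : ReducingSubspace V) : 𝔼.IsometricRep R.toSubmodule where
  fst := V.fst.restrict R.fst
  snd := V.snd.restrict R.snd
  σ_eq := by
    ext a h
    have := congrArg (fun f => f a (h : H)) V.σ_eq
    exact this
  comm z := by
    ext h
    refine (restrict_tensor_T V.snd V.fst 𝔼.prod₂₁ V.σ_eq.symm R.toSubmodule R.isClosed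
      R.snd.map_σ R.map_σ R.map_snd R.map_fst _ z h).trans ?_
    rw [V.comm z]
    exact (restrict_tensor_T V.fst V.snd 𝔼.prod₁₂ V.σ_eq R.toSubmodule R.isClosed
      R.map_σ R.snd.map_σ R.map_fst R.map_snd _ _ h).symm

/-- `K⁽¹⁾ = {h : P₁¹ T̃⁽²⁾ₗ(ξ ⊗ h) = 0 for all l ≥ 0 and ξ ∈ E₂^{⊗ l}}`, invariant for `(σ, T⁽²⁾)`. -/
def K₁ (V : 𝔼.IsometricRep H) : V.snd.InvariantSubspace := V.fst.wandering V.snd V.σ_eq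

/-- `K⁽²⁾ = {h : P₁² T̃⁽¹⁾ₗ(ξ ⊗ h) = 0 for all l ≥ 0 and ξ ∈ E₁^{⊗ l}}`, invariant for `(σ, T⁽¹⁾)`. -/
def K₂ (V : 𝔼.IsometricRep H) : V.fst.InvariantSubspace := V.snd.wandering V.fst V.σ_eq.symm

/-- The representation is weakly bi-induced: each of `(σ, T⁽¹⁾ ⊗ T⁽²⁾)`, `(σ, T⁽¹⁾)|_{K⁽²⁾}` and
`(σ, T⁽²⁾)|_{K⁽¹⁾}` is isomorphic to an induced representation. -/
structure IsWeaklyBiInduced (V : 𝔼.IsometricRep H) : Prop where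
  prod : V.prod.IsInduced
  fst : (V.fst.restrict V.K₂).IsInduced
  snd : (V.snd.restrict V.K₁).IsInduced

/-- `H = H₀ ⊕ H₁ ⊕ H₂ ⊕ Hwi` is an orthogonal decomposition into reducing subspaces such that `H₀` is
fully coisometric, `H₁` is induced for `T⁽¹⁾` and fully coisometric for `T⁽²⁾`, `H₂` is fully
coisometric for `T⁽¹⁾` and induced for `T⁽²⁾`, and `Hwi` is weakly bi-induced. -/
structure IsWoldDecomposition (V : 𝔼.IsometricRep H) (H₀ H₁ H₂ Hwi : ReducingSubspace V) :
    Prop where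
  orthogonal : [H₀, H₁, H₂, Hwi].Pairwise fun M N => M.toSubmodule ⟂ N.toSubmodule
  sup_eq_top : H₀.toSubmodule ⊔ H₁.toSubmodule ⊔ H₂.toSubmodule ⊔ Hwi.toSubmodule = ⊤
  fst_coisometric₀ : (V.restrict H₀).fst.IsFullyCoisometric
  fst_coisometric₂ : (V.restrict H₂).fst.IsFullyCoisometric
  snd_coisometric₀ : (V.restrict H₀).snd.IsFullyCoisometric
  snd_coisometric₁ : (V.restrict H₁).snd.IsFullyCoisometric
  fst_induced₁ : (V.restrict H₁).fst.IsInduced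
  snd_induced₂ : (V.restrict H₂).snd.IsInduced
  weaklyBiInduced : (V.restrict Hwi).IsWeaklyBiInduced

end IsometricRep
end ProductSystem

end Representations
end Wold

end

/-!
Everything takes place inside `H`. For a subspace `M`, let `S.img M` be the closed span of the vectors
`S.T ξ h` with `h ∈ M`. For closed `M` invariant under `σ(A)`, membership in `S.img M` means lying
in the range of `T̃` and being mapped into `M` by all `T(ξ)*` (`mem_img_iff`); so `S.img` commutes
with intersections and is compatible with orthogonal complements. Since `H` itself can serve as
`E ⊗_σ H` when `T̃` is unitary, and the subspaces `S.img^[n] (S.img ⊤)ᗮ` form the Fock tower of the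
wandering subspace, being fully coisometric means `S.img ⊤ = ⊤` (`isFullyCoisometric_iff`), and being
induced means `⨅ n, S.img^[n] ⊤ = ⊥` (`isInduced_iff`). The unitary `t` makes the maps `img` of `T⁽¹⁾`
and `T⁽²⁾` commute, and their composition is the map `img` of `T⁽¹⁾ ⊗ T⁽²⁾`. What remains is the
argument for a pair of commuting isometries.

* `H₀ = ⨅ n, V.prod.img^[n] ⊤` is the fully coisometric part of `T⁽¹⁾ ⊗ T⁽²⁾`.
* `L = ⨅ n, V.fst.img^[n] K⁽²⁾` satisfies `V.fst.img L = L` and is orthogonal to the range of `T̃⁽²⁾`,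
  so the subspace `H₂` that it generates under `T⁽²⁾` reduces both representations, with `T⁽¹⁾` fully
  coisometric and `T⁽²⁾` induced on it (`mixedPart`). `H₁` is obtained by exchanging the roles.
* On the orthogonal complement of `H₀ ⊔ H₁ ⊔ H₂` the three obstructions to being weakly bi-induced
  vanish, being contained in `H₀`, `H₂` and `H₁` respectively.

For uniqueness, let `H₂'` be the summand in another decomposition. Its wandering subspace
`H₂' ⊖ V.snd.img H₂'` is a fixed point of `V.fst.img` inside `K⁽²⁾`, hence lies in `L`, so `H₂' ≤ H₂`.
Conversely `L` is orthogonal to the weakly bi-induced summand, since the projection onto that summand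
maps `L` into `⨅ n, V.fst.img^[n] (K⁽²⁾ ⊓ Hwi') = ⊥`, and to the two summands on which `T⁽²⁾` is fully
coisometric; hence `L ≤ H₂'` (`eq_mixedPart`). The remaining summands are then determined by
orthogonality (`IsWoldDecomposition.eq`).
-/

noncomputable section
namespace Wold

/-! ### Subspaces invariant under `σ(A)` -/

variable {A : Type u} [NonUnitalCStarAlgebra A]
variable {H : Type w} [NormedAddCommGroup H] [InnerProductSpace ℂ H]

lemma isClosed_iInf {ι : Sort*} {M : ι → Submodule ℂ H} (hM : ∀ i, IsClosed (M i : Set H)) :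
    IsClosed ((⨅ i, M i : Submodule ℂ H) : Set H) := by
  rw [Submodule.coe_iInf]
  exact isClosed_iInter hM

variable [CompleteSpace H]

/-- `M` is invariant under all the operators `σ(a)`. -/
def SigmaInvariant (σ : A →⋆ₙₐ[ℂ] (H →L[ℂ] H)) (M : Submodule ℂ H) : Prop :=
  ∀ a, ∀ h ∈ M, σ a h ∈ M

lemma SigmaInvariant.orthogonal {σ : A →⋆ₙₐ[ℂ] (H →L[ℂ] H)} {M : Submodule ℂ H}
    (hM : SigmaInvariant σ M) : SigmaInvariant σ Mᗮ := by
  intro a h hh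
  refine (Submodule.mem_orthogonal _ _).2 fun u hu => ?_
  rw [← star_star a, map_star, ContinuousLinearMap.star_eq_adjoint,
    ContinuousLinearMap.adjoint_inner_right]
  exact (Submodule.mem_orthogonal _ _).1 hh _ (hM _ u hu)

lemma SigmaInvariant.inf {σ : A →⋆ₙₐ[ℂ] (H →L[ℂ] H)} {M N : Submodule ℂ H}
    (hM : SigmaInvariant σ M) (hN : SigmaInvariant σ N) : SigmaInvariant σ (M ⊓ N) :=
  fun a h hh => ⟨hM a h hh.1, hN a h hh.2⟩

lemma SigmaInvariant.iInf {ι : Sort*} {σ : A →⋆ₙₐ[ℂ] (H →L[ℂ] H)} {M : ι → Submodule ℂ H}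
    (hM : ∀ i, SigmaInvariant σ (M i)) : SigmaInvariant σ (⨅ i, M i) := by
  intro a h hh
  rw [Submodule.mem_iInf] at hh ⊢
  exact fun i => hM i a h (hh i)

lemma SigmaInvariant.top (σ : A →⋆ₙₐ[ℂ] (H →L[ℂ] H)) : SigmaInvariant σ ⊤ :=
  fun _ _ _ => trivial

variable [PartialOrder A] [StarOrderedRing A]

/-! ### The range of `T̃` on a subspace -/

namespace IsometricRep

variable {E F : Correspondence.{u, v} A}

/-- The closed linear span of the vectors `T(ξ)h` with `h ∈ M`: for `M` invariant under `σ(A)`, the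
range of `T̃` on `E ⊗_σ M`. -/
def img (S : IsometricRep H E) (M : Submodule ℂ H) : Submodule ℂ H :=
  (Submodule.span ℂ {v : H | ∃ ξ, ∃ h ∈ M, S.T ξ h = v}).topologicalClosure

variable (S : IsometricRep H E) (T : IsometricRep H F) {M N : Submodule ℂ H}

lemma isClosed_img (M : Submodule ℂ H) : IsClosed (S.img M : Set H) :=
  Submodule.isClosed_topologicalClosure _

lemma T_mem_img (ξ : E) {h : H} (hh : h ∈ M) : S.T ξ h ∈ S.img M :=
  Submodule.le_topologicalClosure _ (Submodule.subset_span ⟨ξ, h, hh, rfl⟩)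

variable {S} in
lemma img_le (hN : IsClosed (N : Set H)) (h : ∀ ξ, ∀ h ∈ M, S.T ξ h ∈ N) : S.img M ≤ N := by
  refine Submodule.topologicalClosure_minimal _ (Submodule.span_le.2 ?_) hN
  rintro _ ⟨ξ, k, hk, rfl⟩
  exact h ξ k hk

lemma img_mono : Monotone S.img := fun _ N h =>
  img_le (S.isClosed_img N) fun ξ _ hk => S.T_mem_img ξ (h hk)

lemma img_top : S.img ⊤ = S.rangeClosure := by
  simp [img, rangeClosure]

lemma sigmaInvariant_img (M : Submodule ℂ H) : SigmaInvariant S.σ (S.img M) := by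
  intro a
  have : S.img M ≤ (S.img M).comap (S.σ a).toLinearMap := by
    refine img_le ((S.isClosed_img M).preimage (S.σ a).continuous) fun ξ h hh => ?_
    rw [Submodule.mem_comap]
    have := S.T_mem_img (E.lact a ξ) hh
    rwa [S.map_lact] at this
  exact fun h hh => this hh

variable {S} in
/-- A subspace is mapped by a continuous operator into another one as soon as the generators of
`S.img M` are. -/
lemma map_img_le {B : H →L[ℂ] H} (hN : IsClosed (N : Set H))
    (h : ∀ ξ, ∀ h ∈ M, B (S.T ξ h) ∈ N) : ∀ x ∈ S.img M, B x ∈ N := by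
  have : S.img M ≤ N.comap B.toLinearMap :=
    img_le (hN.preimage B.continuous) h
  exact fun x hx => this hx

lemma mem_orthogonal_img {x : H} : x ∈ (S.img M)ᗮ ↔ ∀ ξ, ∀ h ∈ M, ⟪S.T ξ h, x⟫_ℂ = 0 := by
  refine ⟨fun hx ξ h hh => (Submodule.mem_orthogonal _ _).1 hx _ (S.T_mem_img ξ hh), fun h => ?_⟩
  have : S.img M ≤ (ℂ ∙ x)ᗮ := by
    refine img_le (Submodule.isClosed_orthogonal _) fun ξ k hk => ?_
    rw [Submodule.mem_orthogonal_singleton_iff_inner_left]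
    exact h ξ k hk
  refine (Submodule.mem_orthogonal _ _).2 fun u hu => ?_
  exact Submodule.mem_orthogonal_singleton_iff_inner_left.1 (this hu)

lemma mem_orthogonal_img_iff_star {x : H} :
    x ∈ (S.img M)ᗮ ↔ ∀ ξ, star (S.T ξ) x ∈ Mᗮ := by
  rw [mem_orthogonal_img]
  simp only [Submodule.mem_orthogonal, ContinuousLinearMap.star_eq_adjoint,
    ContinuousLinearMap.adjoint_inner_right]

lemma star_T_T (ξ η : E) (h : H) : star (S.T ξ) (S.T η h) = S.σ (E.ip ξ η) h := by
  rw [← S.isometric, mul_apply_eq_comp]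

variable {S} in
lemma star_T_mem (hM : IsClosed (M : Set H)) (hσ : SigmaInvariant S.σ M) (ξ : E) {x : H}
    (hx : x ∈ S.img M) : star (S.T ξ) x ∈ M :=
  map_img_le hM (fun η h hh => by rw [star_T_T]; exact hσ _ _ hh) x hx

variable {S} in
/-- Membership in `T̃(E ⊗_σ M)` can be tested by the operators `T(ξ)*`. This makes `S.img` compatible
with intersections and orthogonal complements. -/
lemma mem_img_iff (hM : IsClosed (M : Set H)) (hσ : SigmaInvariant S.σ M) {x : H} :
    x ∈ S.img M ↔ x ∈ S.img ⊤ ∧ ∀ ξ, star (S.T ξ) x ∈ M := by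
  refine ⟨fun hx => ⟨S.img_mono le_top hx, fun ξ => star_T_mem hM hσ ξ hx⟩, fun ⟨hx, h⟩ => ?_⟩
  have : CompleteSpace (S.img M) := (S.isClosed_img M).completeSpace_coe
  obtain ⟨q, hq, r, hr, rfl⟩ := (S.img M).exists_add_mem_mem_orthogonal x
  -- the component `r` orthogonal to `S.img M` is annihilated by all `T(ξ)*`
  have hr0 : ∀ ξ, star (S.T ξ) r = 0 := fun ξ => by
    have h1 : star (S.T ξ) r ∈ M := by
      have := M.sub_mem (h ξ) (star_T_mem hM hσ ξ hq)
      rwa [map_add, add_sub_cancel_left] at this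
    exact inner_self_eq_zero.1 ((Submodule.mem_orthogonal _ _).1
      (S.mem_orthogonal_img_iff_star.1 hr ξ) _ h1)
  have hr1 : r ∈ (S.img ⊤)ᗮ := S.mem_orthogonal_img_iff_star.2 fun ξ => by simp [hr0]
  have hr2 : r ∈ S.img ⊤ := by
    have := (S.img ⊤).sub_mem hx (S.img_mono le_top hq)
    rwa [add_sub_cancel_left] at this
  have : r = 0 := inner_self_eq_zero.1 ((Submodule.mem_orthogonal _ _).1 hr1 _ hr2)
  rwa [this, add_zero]

variable {S} in
lemma img_iInf {ι : Sort*} [Nonempty ι] {M : ι → Submodule ℂ H}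
    (hM : ∀ i, IsClosed (M i : Set H)) (hσ : ∀ i, SigmaInvariant S.σ (M i)) :
    S.img (⨅ i, M i) = ⨅ i, S.img (M i) := by
  ext x
  rw [mem_img_iff (isClosed_iInf hM) (SigmaInvariant.iInf hσ)]
  simp only [Submodule.mem_iInf, mem_img_iff (hM _) (hσ _)]
  exact ⟨fun h i => ⟨h.1, fun ξ => h.2 ξ i⟩,
    fun h => ⟨(h (Classical.arbitrary ι)).1, fun ξ i => (h i).2 ξ⟩⟩

variable {S} in
lemma img_inf (hM : IsClosed (M : Set H)) (hσM : SigmaInvariant S.σ M)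
    (hN : IsClosed (N : Set H)) (hσN : SigmaInvariant S.σ N) :
    S.img (M ⊓ N) = S.img M ⊓ S.img N := by
  rw [inf_eq_iInf, inf_eq_iInf, img_iInf]
  · congr 1
    ext b : 1
    cases b <;> rfl
  · simp [hM, hN]
  · simp [hσM, hσN]

variable {S} in
lemma img_orthogonal (hσ : SigmaInvariant S.σ M) : S.img Mᗮ = S.img ⊤ ⊓ (S.img M)ᗮ := by
  ext x
  rw [mem_img_iff (Submodule.isClosed_orthogonal _) hσ.orthogonal, Submodule.mem_inf,
    mem_orthogonal_img_iff_star]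

lemma img_topologicalClosure (M : Submodule ℂ H) : S.img M.topologicalClosure = S.img M := by
  refine le_antisymm (img_le (S.isClosed_img M) fun ξ h hh => ?_)
    (S.img_mono M.le_topologicalClosure)
  have : M.topologicalClosure ≤ (S.img M).comap (S.T ξ).toLinearMap :=
    Submodule.topologicalClosure_minimal _ (fun k hk => S.T_mem_img ξ hk)
      ((S.isClosed_img M).preimage (S.T ξ).continuous)
  exact this hh

lemma img_iSup {ι : Sort*} (M : ι → Submodule ℂ H) :
    S.img (⨆ i, M i) = (⨆ i, S.img (M i)).topologicalClosure := by
  refine le_antisymm (img_le (Submodule.isClosed_topologicalClosure _) fun ξ h hh => ?_) ?_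
  · refine Submodule.le_topologicalClosure _ ?_
    have : (⨆ i, M i) ≤ (⨆ i, S.img (M i)).comap (S.T ξ).toLinearMap :=
      iSup_le fun i k hk => Submodule.mem_iSup_of_mem i (S.T_mem_img ξ hk)
    exact this hh
  · exact Submodule.topologicalClosure_minimal _
      (iSup_le fun i => S.img_mono (le_iSup M i)) (S.isClosed_img _)

/-! ### Iterates -/

lemma isClosed_iterate_img (hM : IsClosed (M : Set H)) (n : ℕ) :
    IsClosed (S.img^[n] M : Set H) := by
  cases n with
  | zero => exact hM
  | succ n => rw [Function.iterate_succ_apply']; exact S.isClosed_img _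

variable {S} in
lemma sigmaInvariant_iterate_img (hM : SigmaInvariant S.σ M) (n : ℕ) :
    SigmaInvariant S.σ (S.img^[n] M) := by
  cases n with
  | zero => exact hM
  | succ n => rw [Function.iterate_succ_apply']; exact S.sigmaInvariant_img _

variable {S} in
/-- The part of an `img`-invariant subspace that survives all iterates is a fixed point. -/
lemma img_iInf_iterate (hM : IsClosed (M : Set H)) (hσ : SigmaInvariant S.σ M)
    (h : S.img M ≤ M) : S.img (⨅ n, S.img^[n] M) = ⨅ n, S.img^[n] M := by
  rw [img_iInf (S.isClosed_iterate_img hM) (sigmaInvariant_iterate_img hσ)]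
  have := (S.img_mono.antitone_iterate_of_map_le h)
  simp only [← Function.iterate_succ_apply']
  exact le_antisymm (le_iInf fun n => (iInf_le _ n).trans (this n.le_succ))
    (le_iInf fun n => iInf_le _ (n + 1))

variable {S} in
lemma le_iInf_iterate (h : M ≤ N) (hM : S.img M = M) : M ≤ ⨅ n, S.img^[n] N :=
  le_iInf fun n => by
    conv_lhs => rw [← Function.iterate_fixed hM n]
    exact S.img_mono.iterate n h

/-! ### Reducing subspaces -/

/-- The closed subspace `M` reduces `(σ, T)`. Invariance of the complement under `T(ξ)` is expressed
through `T(ξ)*`. -/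
structure Reduces (S : IsometricRep H E) (M : Submodule ℂ H) : Prop where
  isClosed : IsClosed (M : Set H)
  map_σ : SigmaInvariant S.σ M
  map_T : ∀ ξ, ∀ h ∈ M, S.T ξ h ∈ M
  map_star : ∀ ξ, ∀ h ∈ M, star (S.T ξ) h ∈ M

variable {S}

lemma Reduces.map_T_orthogonal (hM : S.Reduces M) (ξ : E) {h : H} (hh : h ∈ Mᗮ) :
    S.T ξ h ∈ Mᗮ := by
  refine (Submodule.mem_orthogonal _ _).2 fun u hu => ?_
  rw [← ContinuousLinearMap.adjoint_inner_left]
  exact (Submodule.mem_orthogonal _ _).1 hh _ (hM.map_star ξ u hu)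

lemma Reduces.mk_of_orthogonal (hM : IsClosed (M : Set H)) (hσ : SigmaInvariant S.σ M)
    (hT : ∀ ξ, ∀ h ∈ M, S.T ξ h ∈ M) (hT' : ∀ ξ, ∀ h ∈ Mᗮ, S.T ξ h ∈ Mᗮ) : S.Reduces M := by
  refine ⟨hM, hσ, hT, fun ξ h hh => ?_⟩
  have : CompleteSpace M := hM.completeSpace_coe
  rw [← M.orthogonal_orthogonal]
  refine (Submodule.mem_orthogonal _ _).2 fun u hu => ?_
  rw [ContinuousLinearMap.star_eq_adjoint, ContinuousLinearMap.adjoint_inner_right]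
  exact Submodule.inner_left_of_mem_orthogonal hh (hT' ξ u hu)

lemma Reduces.orthogonal (hM : S.Reduces M) : S.Reduces Mᗮ := by
  refine ⟨Submodule.isClosed_orthogonal _, hM.map_σ.orthogonal,
    fun ξ h hh => hM.map_T_orthogonal ξ hh, fun ξ h hh => ?_⟩
  refine (Submodule.mem_orthogonal _ _).2 fun u hu => ?_
  rw [ContinuousLinearMap.star_eq_adjoint, ContinuousLinearMap.adjoint_inner_right]
  exact (Submodule.mem_orthogonal _ _).1 hh _ (hM.map_T ξ u hu)

lemma Reduces.img_le (hM : S.Reduces M) : S.img M ≤ M :=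
  IsometricRep.img_le hM.isClosed hM.map_T

lemma Reduces.inf (hM : S.Reduces M) (hN : S.Reduces N) : S.Reduces (M ⊓ N) where
  isClosed := hM.isClosed.inter hN.isClosed
  map_σ := hM.map_σ.inf hN.map_σ
  map_T ξ h hh := ⟨hM.map_T ξ h hh.1, hN.map_T ξ h hh.2⟩
  map_star ξ h hh := ⟨hM.map_star ξ h hh.1, hN.map_star ξ h hh.2⟩

lemma reduces_of_img_eq (hσ : SigmaInvariant S.σ M) (h : S.img M = M) :
    S.Reduces M := by
  have hM : IsClosed (M : Set H) := h ▸ S.isClosed_img M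
  exact ⟨hM, hσ, fun ξ k hk => h.le (S.T_mem_img ξ hk), fun ξ k hk => star_T_mem hM hσ ξ (h.ge hk)⟩

/-- The projection onto a reducing subspace commutes with `T(ξ)`. -/
lemma Reduces.starProjection_T [M.HasOrthogonalProjection] (hM : S.Reduces M) (ξ : E) (h : H) :
    M.starProjection (S.T ξ h) = S.T ξ (M.starProjection h) := by
  refine (Submodule.eq_starProjection_of_mem_orthogonal
    (hM.map_T ξ _ (Submodule.starProjection_apply_mem _ _)) ?_)
  rw [← map_sub]
  exact hM.map_T_orthogonal ξ (Submodule.sub_starProjection_mem_orthogonal _)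

lemma Reduces.starProjection_img {N' : Submodule ℂ H} [M.HasOrthogonalProjection]
    (hM : S.Reduces M) (h : ∀ x ∈ N, M.starProjection x ∈ N') :
    ∀ x ∈ S.img N, M.starProjection x ∈ S.img N' :=
  map_img_le (S.isClosed_img _) fun ξ k hk => by
    rw [hM.starProjection_T]; exact S.T_mem_img ξ (h k hk)

lemma Reduces.starProjection_iterate_img {N' : Submodule ℂ H} [M.HasOrthogonalProjection]
    (hM : S.Reduces M) (h : ∀ x ∈ N, M.starProjection x ∈ N') (n : ℕ) :
    ∀ x ∈ S.img^[n] N, M.starProjection x ∈ S.img^[n] N' := by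
  induction n with
  | zero => exact h
  | succ n ih =>
    rw [Function.iterate_succ_apply', Function.iterate_succ_apply']
    exact hM.starProjection_img ih

lemma Reduces.starProjection_iInf {N' : Submodule ℂ H} [M.HasOrthogonalProjection]
    (hM : S.Reduces M) (h : ∀ x ∈ N, M.starProjection x ∈ N') (h0 : ⨅ n, S.img^[n] N' = ⊥) :
    ⨅ n, S.img^[n] N ≤ Mᗮ := by
  intro x hx
  rw [← Submodule.starProjection_apply_eq_zero_iff, ← Submodule.mem_bot ℂ, ← h0]
  rw [Submodule.mem_iInf] at hx ⊢
  exact fun n => hM.starProjection_iterate_img h n x (hx n)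

/-! ### The wandering part of an invariant subspace -/

variable (S) in
lemma iterate_img_orthogonal (hN : SigmaInvariant S.σ N) (h : M ⟂ N) (n : ℕ) :
    S.img^[n] M ⟂ S.img^[n] N := by
  induction n with
  | zero => exact h
  | succ n ih =>
    rw [Function.iterate_succ_apply', Function.iterate_succ_apply']
    refine IsometricRep.img_le (Submodule.isClosed_orthogonal _) fun ξ k hk => ?_
    rw [mem_orthogonal_img]
    intro η l hl
    rw [inner_T]
    exact Submodule.inner_right_of_mem_orthogonal hl
      ((sigmaInvariant_iterate_img hN n).orthogonal _ _ (ih hk))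

/-- Vectors of `M` orthogonal to all `imgⁿ (M ⊖ img M)` lie in all `imgⁿ M`. -/
lemma mem_iInf_of_orthogonal (hM : IsClosed (M : Set H)) (hσ : SigmaInvariant S.σ M)
    (h : S.img M ≤ M) {x : H} (hx : x ∈ M)
    (hxo : ∀ n, x ∈ (S.img^[n] (M ⊓ (S.img M)ᗮ))ᗮ) : x ∈ ⨅ n, S.img^[n] M := by
  rw [Submodule.mem_iInf]
  intro n
  have : ∀ n, ∀ M : Submodule ℂ H, IsClosed (M : Set H) → SigmaInvariant S.σ M → S.img M ≤ M →
      ∀ x ∈ S.img^[n] M, x ∈ (S.img^[n] (M ⊓ (S.img M)ᗮ))ᗮ → x ∈ S.img^[n + 1] M := by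
    intro n
    induction n with
    | zero =>
      intro M hM hσ h x hx hx'
      simp only [Function.iterate_zero, id, zero_add, Function.iterate_one] at hx hx' ⊢
      have : CompleteSpace (S.img M) := (S.isClosed_img M).completeSpace_coe
      obtain ⟨q, hq, r, hr, rfl⟩ := (S.img M).exists_add_mem_mem_orthogonal x
      have hr' : r ∈ M ⊓ (S.img M)ᗮ :=
        ⟨by simpa using M.sub_mem hx (h hq), hr⟩
      have h0 := (Submodule.mem_orthogonal _ _).1 hx' r hr'
      rw [inner_add_right, Submodule.inner_left_of_mem_orthogonal hq hr, zero_add] at h0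
      rw [inner_self_eq_zero.1 h0, add_zero]
      exact hq
    | succ n ih =>
      intro M hM hσ h x hx hx'
      rw [Function.iterate_succ_apply] at hx hx' ⊢
      refine ih (S.img M) (S.isClosed_img _) (S.sigmaInvariant_img _) (S.img_mono h) x hx ?_
      rw [img_inf hM hσ (Submodule.isClosed_orthogonal _) (S.sigmaInvariant_img _).orthogonal,
        img_orthogonal (S.sigmaInvariant_img _), ← inf_assoc,
        inf_eq_left.2 (S.img_mono (le_top : M ≤ ⊤))] at hx'
      exact hx'
  induction n with
  | zero => exact hx
  | succ n ih => exact this n M hM hσ h x ih (hxo n)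

/-- If `M` has no part surviving all iterates, it is generated by `M ⊖ img M`. -/
lemma le_closure_iSup_of_iInf_eq_bot (hM : IsClosed (M : Set H)) (hσ : SigmaInvariant S.σ M)
    (h : S.img M ≤ M) (h0 : ⨅ n, S.img^[n] M = ⊥) :
    M ≤ (⨆ n, S.img^[n] (M ⊓ (S.img M)ᗮ)).topologicalClosure := by
  set G := (⨆ n, S.img^[n] (M ⊓ (S.img M)ᗮ)).topologicalClosure with hG
  have hGc : IsClosed (G : Set H) := Submodule.isClosed_topologicalClosure _
  have : CompleteSpace G := hGc.completeSpace_coe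
  have hle : ∀ n, S.img^[n] (M ⊓ (S.img M)ᗮ) ≤ G := fun n =>
    (le_iSup (fun n => S.img^[n] (M ⊓ (S.img M)ᗮ)) n).trans (Submodule.le_topologicalClosure _)
  have hGM : G ≤ M := Submodule.topologicalClosure_minimal _ (iSup_le fun n =>
    (S.img_mono.iterate n inf_le_left).trans
      ((S.img_mono.antitone_iterate_of_map_le h) (Nat.zero_le n))) hM
  intro x hx
  obtain ⟨q, hq, r, hr, rfl⟩ := G.exists_add_mem_mem_orthogonal x
  have : r ∈ ⨅ n, S.img^[n] M := mem_iInf_of_orthogonal hM hσ h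
    (by simpa using M.sub_mem hx (hGM hq)) fun n => Submodule.orthogonal_le (hle n) hr
  rw [h0, Submodule.mem_bot] at this
  rwa [this, add_zero]

end IsometricRep
end Wold
end

noncomputable section
namespace Wold

/-! ### Operators on subspaces of a subspace -/

lemma map_subtype_iterate {H : Type*} [AddCommGroup H] [Module ℂ H]
    (K : Submodule ℂ H) {f : Submodule ℂ K → Submodule ℂ K}
    {g : Submodule ℂ H → Submodule ℂ H}
    (h : ∀ M : Submodule ℂ K, (f M).map K.subtype = g (M.map K.subtype)) (M : Submodule ℂ K) :
    (⨅ n, f^[n] M).map K.subtype = ⨅ n, g^[n] (M.map K.subtype) := by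
  rw [Submodule.map_iInf _ K.injective_subtype]
  congr 1
  ext1 n
  exact (show Function.Semiconj (Submodule.map K.subtype) f g from h).iterate_right n M

lemma iInf_iterate_eq_bot_iff {H : Type*} [AddCommGroup H] [Module ℂ H]
    (K : Submodule ℂ H) {f : Submodule ℂ K → Submodule ℂ K}
    {g : Submodule ℂ H → Submodule ℂ H}
    (h : ∀ M : Submodule ℂ K, (f M).map K.subtype = g (M.map K.subtype)) (M : Submodule ℂ K) :
    ⨅ n, f^[n] M = ⊥ ↔ ⨅ n, g^[n] (M.map K.subtype) = ⊥ := by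
  rw [← map_subtype_iterate K h, ← (Submodule.map_injective_of_injective
    K.injective_subtype).eq_iff, Submodule.map_bot]

variable {A : Type u} [NonUnitalCStarAlgebra A] [PartialOrder A] [StarOrderedRing A]
variable {H : Type w} [NormedAddCommGroup H] [InnerProductSpace ℂ H] [CompleteSpace H]

namespace IsometricRep

variable {E F : Correspondence.{u, v} A} {S : IsometricRep H E} {M N : Submodule ℂ H}

/-! ### Fully coisometric representations -/

lemma isFullyCoisometric_iff : S.IsFullyCoisometric ↔ S.img ⊤ = ⊤ := by
  rw [img_top]
  constructor
  · rintro ⟨X, _, _, _, τ, T', hτ, hT', h1⟩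
    rw [eq_top_iff]
    rintro h -
    have hle : ∀ z : X, T' z ∈ S.rangeClosure := by
      have hc : IsClosed ((S.rangeClosure.comap T'.toLinearMap : Submodule ℂ X) : Set X) :=
        (Submodule.isClosed_topologicalClosure _).preimage T'.continuous
      have := Submodule.topologicalClosure_minimal (Submodule.span ℂ {z : X | ∃ x h, τ x h = z})
        (t := S.rangeClosure.comap T'.toLinearMap) (Submodule.span_le.2 ?_) hc
      · rw [hτ.dense] at this
        exact fun z => this (Submodule.mem_top (x := z))
      · rintro _ ⟨ξ, k, rfl⟩
        change T' (τ ξ k) ∈ S.rangeClosure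
        rw [hT', ← img_top]
        exact S.T_mem_img ξ trivial
    have := congrArg (fun f => f h) h1
    simp only [ContinuousLinearMap.comp_apply, ContinuousLinearMap.id_apply] at this
    exact this ▸ hle _
  · intro h
    -- as `T̃` is unitary, `H` itself serves as a model of `E ⊗_σ H`
    refine ⟨H, inferInstance, inferInstance, inferInstance,
      { toFun := fun ξ => (S.T ξ).toLinearMap
        map_add' := fun ξ η => by ext; simp
        map_smul' := fun c ξ => by ext; simp }, ContinuousLinearMap.id ℂ H, ⟨?_, ?_⟩, ?_, ?_⟩
    · exact fun x y h k => S.inner_T x y h k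
    · exact h
    · exact fun ξ h => rfl
    · ext x
      simp [← ContinuousLinearMap.star_eq_adjoint, ← ContinuousLinearMap.one_def]

/-! ### Restrictions -/

/-- Since `K` is closed, forming `img` inside `K` or inside `H` makes no difference. -/
lemma map_subtype_restrict_img (K : InvariantSubspace S) (M : Submodule ℂ K.toSubmodule) :
    ((S.restrict K).img M).map K.toSubmodule.subtype = S.img (M.map K.toSubmodule.subtype) := by
  apply SetLike.coe_injective
  have hcl : Topology.IsClosedEmbedding K.toSubmodule.subtype :=
    K.isClosed.isClosedEmbedding_subtypeVal
  rw [img, img, Submodule.map_coe, Submodule.topologicalClosure_coe,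
    Submodule.topologicalClosure_coe, ← hcl.closure_image_eq, ← Submodule.map_coe,
    Submodule.map_span]
  congr 3
  ext v
  constructor
  · rintro ⟨_, ⟨ξ, h, hh, rfl⟩, rfl⟩
    exact ⟨ξ, h, ⟨h, hh, rfl⟩, rfl⟩
  · rintro ⟨ξ, _, ⟨h, hh, rfl⟩, rfl⟩
    exact ⟨_, ⟨ξ, h, hh, rfl⟩, rfl⟩

lemma restrict_isFullyCoisometric_iff (K : InvariantSubspace S) :
    (S.restrict K).IsFullyCoisometric ↔ S.img K.toSubmodule = K.toSubmodule := by
  rw [isFullyCoisometric_iff, ← (Submodule.map_injective_of_injective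
    K.toSubmodule.injective_subtype).eq_iff, map_subtype_restrict_img, Submodule.map_top,
    Submodule.range_subtype]

end IsometricRep
end Wold
end

noncomputable section
namespace Wold

/-! ### Induced representations -/

section

variable {A : Type u} [NonUnitalCStarAlgebra A]
variable {H : Type w} [NormedAddCommGroup H] [InnerProductSpace ℂ H] [CompleteSpace H]

/-- The restriction of a `*`-representation to a closed invariant subspace. -/
def restrictRep (σ : A →⋆ₙₐ[ℂ] (H →L[ℂ] H)) (K : Submodule ℂ H) [CompleteSpace K]
    (hK : SigmaInvariant σ K) : A →⋆ₙₐ[ℂ] (K →L[ℂ] K) where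
  toFun a := IsometricRep.InvariantSubspace.restrictOp K (σ a) (hK a)
  map_smul' c a := by ext h; simp
  map_zero' := by ext h; simp
  map_add' a b := by ext h; simp
  map_mul' a b := by ext h; simp
  map_star' a := by
    rw [ContinuousLinearMap.star_eq_adjoint, ContinuousLinearMap.eq_adjoint_iff]
    intro x y
    simp only [Submodule.coe_inner, IsometricRep.InvariantSubspace.coe_restrictOp, map_star,
      ContinuousLinearMap.star_eq_adjoint, ContinuousLinearMap.adjoint_inner_left]

@[simp] lemma coe_restrictRep (σ : A →⋆ₙₐ[ℂ] (H →L[ℂ] H)) (K : Submodule ℂ H) [CompleteSpace K]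
    (hK : SigmaInvariant σ K) (a : A) (h : K) : (restrictRep σ K hK a h : H) = σ a h := rfl

lemma nondegenerate_iff (σ : A →⋆ₙₐ[ℂ] (H →L[ℂ] H)) :
    Nondegenerate σ ↔ ∀ x, (∀ a, σ a x = 0) → x = 0 := by
  have key : ∀ x : H, x ∈ (Submodule.span ℂ {v : H | ∃ a h, σ a h = v})ᗮ ↔ ∀ a, σ a x = 0 := by
    intro x
    rw [Submodule.mem_orthogonal]
    refine ⟨fun h a => ?_, fun h u hu => ?_⟩
    · rw [← inner_self_eq_zero (𝕜 := ℂ), ← ContinuousLinearMap.adjoint_inner_left,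
        ← ContinuousLinearMap.star_eq_adjoint, ← map_star]
      exact h _ (Submodule.subset_span ⟨_, _, rfl⟩)
    · induction hu using Submodule.span_induction with
      | mem u hu =>
        obtain ⟨a, k, rfl⟩ := hu
        rw [← ContinuousLinearMap.adjoint_inner_right, ← ContinuousLinearMap.star_eq_adjoint,
          ← map_star, h, inner_zero_right]
      | zero => simp
      | add u v _ _ hu hv => rw [inner_add_left, hu, hv, add_zero]
      | smul c u _ hu => rw [inner_smul_left, hu, mul_zero]
  rw [Nondegenerate, Submodule.topologicalClosure_eq_top_iff, Submodule.eq_bot_iff]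
  simp only [key]

lemma nondegenerate_restrictRep {σ : A →⋆ₙₐ[ℂ] (H →L[ℂ] H)} (hσ : Nondegenerate σ)
    (K : Submodule ℂ H) [CompleteSpace K] (hK : SigmaInvariant σ K) :
    Nondegenerate (restrictRep σ K hK) := by
  rw [nondegenerate_iff] at hσ ⊢
  exact fun x hx => Subtype.ext (hσ x fun a => congrArg Subtype.val (hx a))

end

variable {A : Type u} [NonUnitalCStarAlgebra A] [PartialOrder A] [StarOrderedRing A]
variable {H : Type w} [NormedAddCommGroup H] [InnerProductSpace ℂ H] [CompleteSpace H]

namespace IsometricRep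

variable {E F : Correspondence.{u, v} A} (S : IsometricRep H E) {M N : Submodule ℂ H}

/-- The subspace `T̃ₙ(E^{⊗ n} ⊗ K)` of `H`, where `K = (T̃(E ⊗ H))ᗮ`. -/
def fockSpace (n : ℕ) : Submodule ℂ H := S.img^[n] (S.img ⊤)ᗮ

lemma fockSpace_succ (n : ℕ) : S.fockSpace (n + 1) = S.img (S.fockSpace n) :=
  Function.iterate_succ_apply' _ _ _

lemma sigmaInvariant_fockSpace (n : ℕ) : SigmaInvariant S.σ (S.fockSpace n) :=
  sigmaInvariant_iterate_img (S.sigmaInvariant_img _).orthogonal n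

instance (n : ℕ) : CompleteSpace (S.fockSpace n) :=
  (S.isClosed_iterate_img (Submodule.isClosed_orthogonal _) n).completeSpace_coe

lemma T_mem_fockSpace {n : ℕ} (ξ : E) {h : H} (hh : h ∈ S.fockSpace n) :
    S.T ξ h ∈ S.fockSpace (n + 1) := by
  rw [fockSpace_succ]
  exact S.T_mem_img ξ hh

/-- The creation maps, given by `ξ ⊗ x ↦ T(ξ)x`. -/
def fockMul (n : ℕ) : E →ₗ[ℂ] S.fockSpace n →ₗ[ℂ] S.fockSpace (n + 1) :=
  LinearMap.mk₂ ℂ (fun ξ x => ⟨S.T ξ x, S.T_mem_fockSpace ξ x.2⟩)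
    (fun ξ η x => by ext; simp) (fun c ξ x => by ext; simp)
    (fun ξ x y => by ext; simp) (fun c ξ x => by ext; simp)

@[simp] lemma coe_fockMul (n : ℕ) (ξ : E) (x : S.fockSpace n) :
    (S.fockMul n ξ x : H) = S.T ξ x := rfl

/-- The tower `E^{⊗ n} ⊗ K` for the wandering subspace `K = (T̃(E ⊗ H))ᗮ`, realized inside `H`. -/
def fockTower : FockTower E (restrictRep S.σ (S.fockSpace 0) (S.sigmaInvariant_fockSpace 0)) where
  X n := S.fockSpace n
  σ n := restrictRep S.σ (S.fockSpace n) (S.sigmaInvariant_fockSpace n)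
  base := LinearIsometryEquiv.refl ℂ _
  base_σ _ _ := rfl
  tmul := S.fockMul
  isInteriorTensor n :=
    { inner_tmul := fun x y h k => S.inner_T x y h k
      dense := by
        apply Submodule.map_injective_of_injective (S.fockSpace (n + 1)).injective_subtype
        have hcl : Topology.IsClosedEmbedding (S.fockSpace (n + 1)).subtype :=
          (S.isClosed_iterate_img (Submodule.isClosed_orthogonal _)
            (n + 1)).isClosedEmbedding_subtypeVal
        rw [Submodule.map_top, Submodule.range_subtype]
        conv_rhs => rw [fockSpace_succ]
        apply SetLike.coe_injective
        rw [img, Submodule.map_coe, Submodule.topologicalClosure_coe,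
          Submodule.topologicalClosure_coe, ← hcl.closure_image_eq, ← Submodule.map_coe,
          Submodule.map_span]
        congr 3
        ext v
        constructor
        · rintro ⟨_, ⟨ξ, h, rfl⟩, rfl⟩
          exact ⟨ξ, h, h.2, rfl⟩
        · rintro ⟨ξ, h, hh, rfl⟩
          exact ⟨_, ⟨ξ, ⟨h, hh⟩, rfl⟩, rfl⟩ }
  σ_tmul n a ξ x := by
    ext
    simp [S.map_lact]

lemma fockSpace_isOrtho {m n : ℕ} (h : m < n) : S.fockSpace m ⟂ S.fockSpace n := by
  obtain ⟨k, rfl⟩ := Nat.exists_eq_add_of_lt h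
  have h1 : S.fockSpace (m + k + 1) = S.img^[m] (S.fockSpace (k + 1)) := by
    rw [fockSpace, fockSpace, ← Function.iterate_add_apply, add_assoc]
  rw [h1]
  refine S.iterate_img_orthogonal (S.sigmaInvariant_fockSpace _) ?_ m
  rw [fockSpace_succ]
  exact Submodule.orthogonal_le (S.img_mono le_top)

variable {S} in
lemma isHilbertSum_fockSpace (h : ⨅ n, S.img^[n] ⊤ = ⊥) :
    IsHilbertSum ℂ (fun n => S.fockSpace n) fun n => (S.fockSpace n).subtypeₗᵢ := by
  refine IsHilbertSum.mkInternal _ (OrthogonalFamily.of_pairwise fun m n hmn => ?_) ?_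
  · rcases lt_or_gt_of_ne hmn with h | h
    · exact S.fockSpace_isOrtho h
    · exact (S.fockSpace_isOrtho h).symm
  · have := le_closure_iSup_of_iInf_eq_bot (S := S) isClosed_univ (SigmaInvariant.top _) le_top h
    rwa [top_inf_eq] at this

variable {S} in
/-- `(σ, T)` is induced if and only if the ranges of `T̃ₙ` intersect trivially. -/
lemma isInduced_iff : S.IsInduced ↔ ⨅ n, S.img^[n] ⊤ = ⊥ := by
  constructor
  · rintro ⟨K, _, _, _, π, Φ, U, -, hσ, h0, hsucc⟩
    -- vectors in the range of `T̃ₙ` have vanishing coordinates below `n`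
    have key : ∀ k, ∀ h ∈ S.img^[k + 1] ⊤, U h k = 0 := by
      have aux : ∀ k, (∀ h ∈ S.img^[k] ⊤, ∀ ξ, U (S.T ξ h) k = 0) →
          ∀ h ∈ S.img^[k + 1] ⊤, U h k = 0 := by
        intro k hk h hh
        rw [Function.iterate_succ_apply'] at hh
        refine ext_inner_right ℂ fun x => ?_
        rw [inner_zero_left, ← lp.inner_single_right, ← U.apply_symm_apply (lp.single 2 k x),
          U.inner_map_map]
        have : U.symm (lp.single 2 k x) ∈ (S.img (S.img^[k] ⊤))ᗮ := by
          refine S.mem_orthogonal_img.2 fun ξ l hl => ?_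
          rw [← U.inner_map_map, U.apply_symm_apply, lp.inner_single_right, hk l hl,
            inner_zero_left]
        exact (Submodule.mem_orthogonal _ _).1 this _ hh
      intro k
      induction k with
      | zero => exact aux 0 fun h _ ξ => h0 ξ h
      | succ k ih => exact aux (k + 1) fun h hh ξ => by rw [hsucc, ih h hh, map_zero]
    rw [Submodule.eq_bot_iff]
    intro x hx
    rw [Submodule.mem_iInf] at hx
    refine U.map_eq_zero_iff.1 (lp.ext (funext fun k => ?_))
    exact key k x (hx (k + 1))
  · intro h
    have hV := isHilbertSum_fockSpace h
    -- the coordinates of `h` are its projections onto the subspaces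
    have hU : ∀ n (x : S.fockSpace n) (k : H),
        ⟪(x : H), (hV.linearIsometryEquiv k n : H)⟫_ℂ = ⟪(x : H), k⟫_ℂ := by
      intro n x k
      refine (lp.inner_single_left (𝕜 := ℂ) (G := fun n => S.fockSpace n) n x
        (hV.linearIsometryEquiv k)).symm.trans ?_
      rw [← hV.linearIsometryEquiv.symm.inner_map_map,
        hV.linearIsometryEquiv_symm_apply_single, hV.linearIsometryEquiv.symm_apply_apply]
      rfl
    have hext : ∀ n (x y : S.fockSpace n), (∀ z : S.fockSpace n, ⟪(z : H), x⟫_ℂ = ⟪(z : H), y⟫_ℂ) →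
        x = y := fun n x y h => ext_inner_left ℂ h
    have hUσ : ∀ a k n, hV.linearIsometryEquiv (S.σ a k) n
        = restrictRep S.σ _ (S.sigmaInvariant_fockSpace n) a (hV.linearIsometryEquiv k n) := by
      intro a k n
      refine hext n _ _ fun z => ?_
      rw [hU, coe_restrictRep, ← ContinuousLinearMap.adjoint_inner_left,
        ← ContinuousLinearMap.adjoint_inner_left, ← ContinuousLinearMap.star_eq_adjoint,
        ← map_star]
      exact (hU n ⟨_, S.sigmaInvariant_fockSpace n _ _ z.2⟩ k).symm
    refine ⟨S.fockSpace 0, inferInstance, inferInstance, inferInstance, _, S.fockTower,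
      hV.linearIsometryEquiv, nondegenerate_restrictRep S.nondegenerate _ _, hUσ, ?_, ?_⟩
    · intro ξ k
      refine hext 0 _ _ fun z => ?_
      refine (hU 0 z _).trans ?_
      rw [Submodule.inner_left_of_mem_orthogonal (S.T_mem_img ξ (Submodule.mem_top (x := k))) z.2]
      exact (inner_zero_right _).symm
    · intro ξ k n
      refine hext (n + 1) _ _ fun z => ?_
      refine (hU (n + 1) z _).trans ?_
      have hmem : S.T ξ k - S.T ξ (hV.linearIsometryEquiv k n) ∈ (S.fockSpace (n + 1))ᗮ := by
        rw [fockSpace_succ, mem_orthogonal_img]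
        intro η y hy
        rw [inner_sub_right, inner_T, inner_T]
        refine sub_eq_zero.2 ((hU n ⟨y, hy⟩ _).symm.trans ?_)
        rw [hUσ]
        rfl
      have := (Submodule.mem_orthogonal _ _).1 hmem _ z.2
      rw [inner_sub_right] at this
      exact sub_eq_zero.1 this

lemma restrict_isInduced_iff (K : InvariantSubspace S) :
    (S.restrict K).IsInduced ↔ ⨅ n, S.img^[n] K.toSubmodule = ⊥ := by
  rw [isInduced_iff, iInf_iterate_eq_bot_iff _ (map_subtype_restrict_img K), Submodule.map_top,
    Submodule.range_subtype]

end IsometricRep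
end Wold
end

noncomputable section
namespace Wold

variable {A : Type u} [NonUnitalCStarAlgebra A] [PartialOrder A] [StarOrderedRing A]
variable {H : Type w} [NormedAddCommGroup H] [InnerProductSpace ℂ H] [CompleteSpace H]

namespace IsometricRep

variable {E F : Correspondence.{u, v} A} {S : IsometricRep H E} {T : IsometricRep H F}
  {M N : Submodule ℂ H}

/-! ### The subspaces on which the iterates of `T` stay orthogonal to the range of `S̃` -/

lemma mem_wandering_iff (hσ : S.σ = T.σ) {h : H} :
    h ∈ (S.wandering T hσ).toSubmodule ↔
      ∀ l : List F, (l.map T.T).prod h ∈ (S.img ⊤)ᗮ := by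
  rw [img_top]
  exact forall_congr' fun l => S.rangeProj_eq_zero_iff _

lemma wandering_le (hσ : S.σ = T.σ) : (S.wandering T hσ).toSubmodule ≤ (S.img ⊤)ᗮ :=
  fun h hh => by simpa using (mem_wandering_iff hσ).1 hh []

lemma sigmaInvariant_wandering (hσ : S.σ = T.σ) :
    SigmaInvariant T.σ (S.wandering T hσ).toSubmodule :=
  (S.wandering T hσ).map_σ

lemma img_wandering_le (hσ : S.σ = T.σ) :
    T.img (S.wandering T hσ).toSubmodule ≤ (S.wandering T hσ).toSubmodule :=
  img_le (S.wandering T hσ).isClosed (S.wandering T hσ).map_T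

lemma list_prod_mem (h : ∀ ξ, ∀ h ∈ M, T.T ξ h ∈ M) (l : List F) {x : H} (hx : x ∈ M) :
    (l.map T.T).prod x ∈ M := by
  induction l with
  | nil => simpa using hx
  | cons ξ l ih =>
    rw [List.map_cons, List.prod_cons, mul_apply_eq_comp]
    exact h ξ _ ih

lemma le_wandering (hσ : S.σ = T.σ) (h : ∀ ξ, ∀ h ∈ M, T.T ξ h ∈ M) (hM : M ≤ (S.img ⊤)ᗮ) :
    M ≤ (S.wandering T hσ).toSubmodule :=
  fun _ hx => (mem_wandering_iff hσ).2 fun l => hM (list_prod_mem h l hx)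

lemma Reduces.starProjection_list_prod [M.HasOrthogonalProjection] (hM : T.Reduces M) (l : List F)
    (x : H) : M.starProjection ((l.map T.T).prod x) = (l.map T.T).prod (M.starProjection x) := by
  induction l with
  | nil => simp
  | cons ξ l ih =>
    rw [List.map_cons, List.prod_cons, mul_apply_eq_comp, hM.starProjection_T, ih,
      mul_apply_eq_comp]

lemma Reduces.inner_T_starProjection [M.HasOrthogonalProjection] (hM : S.Reduces M) (ξ : E) (h : H)
    {y : H} (hy : y ∈ M) : ⟪S.T ξ (M.starProjection h), y⟫_ℂ = ⟪S.T ξ h, y⟫_ℂ := by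
  rw [← hM.starProjection_T, Submodule.inner_starProjection_left_eq_right,
    Submodule.starProjection_eq_self_iff.2 hy]

lemma Reduces.starProjection_mem_wandering [M.HasOrthogonalProjection] (hσ : S.σ = T.σ)
    (hS : S.Reduces M) (hT : T.Reduces M) {x : H} (hx : x ∈ (S.wandering T hσ).toSubmodule) :
    M.starProjection x ∈ (S.wandering T hσ).toSubmodule ⊓ M := by
  refine ⟨(mem_wandering_iff hσ).2 fun l => ?_, M.starProjection_apply_mem x⟩
  rw [← hT.starProjection_list_prod, mem_orthogonal_img]
  intro ξ h _
  rw [← Submodule.inner_starProjection_left_eq_right, hS.starProjection_T]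
  exact S.mem_orthogonal_img.1 ((mem_wandering_iff hσ).1 hx l) ξ _ trivial

/-- For a reducing subspace `K`, the subspace `wandering` of the restrictions to `K` is the part in
`K` of the subspace `wandering` for the whole space. -/
lemma map_subtype_wandering (hσ : S.σ = T.σ) (K : Submodule ℂ H) (hK : IsClosed (K : Set H))
    (h1 : ∀ a, ∀ h ∈ K, S.σ a h ∈ K) (h1' : ∀ a, ∀ h ∈ K, T.σ a h ∈ K)
    (h2 : ∀ ξ, ∀ h ∈ K, S.T ξ h ∈ K) (h3 : ∀ ξ, ∀ h ∈ K, T.T ξ h ∈ K) (hS : S.Reduces K)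
    (hσ' : (S.restrict ⟨K, hK, h1, h2⟩).σ = (T.restrict ⟨K, hK, h1', h3⟩).σ) :
    Submodule.map K.subtype
      ((S.restrict ⟨K, hK, h1, h2⟩).wandering (T.restrict ⟨K, hK, h1', h3⟩) hσ').toSubmodule =
      (S.wandering T hσ).toSubmodule ⊓ K := by
  have : CompleteSpace K := hK.completeSpace_coe
  have hl : ∀ (l : List F) (x : K),
      (((l.map (T.restrict ⟨K, hK, h1', h3⟩).T).prod x : K) : H) = (l.map T.T).prod x := by
    intro l x
    induction l with
    | nil => simp
    | cons ξ l ih =>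
      rw [List.map_cons, List.map_cons, List.prod_cons, List.prod_cons, mul_apply_eq_comp,
        mul_apply_eq_comp, ← ih]
      rfl
  have ho : ∀ y : K, y ∈ ((S.restrict ⟨K, hK, h1, h2⟩).img ⊤)ᗮ ↔ (y : H) ∈ (S.img ⊤)ᗮ := by
    intro y
    rw [mem_orthogonal_img, mem_orthogonal_img]
    refine ⟨fun h ξ k _ => ?_, fun h ξ k _ => h ξ k trivial⟩
    rw [← hS.inner_T_starProjection ξ k y.2]
    exact h ξ ⟨_, K.starProjection_apply_mem k⟩ trivial
  have hmem : ∀ x : K,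
      x ∈ ((S.restrict ⟨K, hK, h1, h2⟩).wandering (T.restrict ⟨K, hK, h1', h3⟩) hσ').toSubmodule ↔
        (x : H) ∈ (S.wandering T hσ).toSubmodule := fun x =>
    (mem_wandering_iff hσ').trans (Iff.trans
      (forall_congr' fun l => by rw [ho, hl]) (mem_wandering_iff hσ).symm)
  ext x
  constructor
  · rintro ⟨y, hy, rfl⟩
    exact ⟨(hmem y).1 hy, y.2⟩
  · rintro ⟨hx, hxK⟩
    exact ⟨⟨x, hxK⟩, (hmem _).2 hx, rfl⟩

/-! ### The part where `T` is fully coisometric and `S` is induced -/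

/-- The largest subspace of `S.wandering T` that is a fixed point of `T.img`. -/
def mixedCore (S : IsometricRep H E) (T : IsometricRep H F) (hσ : S.σ = T.σ) : Submodule ℂ H :=
  ⨅ n, T.img^[n] (S.wandering T hσ).toSubmodule

/-- The subspace generated by `S.mixedCore T` under `S`. -/
def mixedPart (S : IsometricRep H E) (T : IsometricRep H F) (hσ : S.σ = T.σ) : Submodule ℂ H :=
  (⨆ n, S.img^[n] (S.mixedCore T hσ)).topologicalClosure

lemma img_mixedCore (hσ : S.σ = T.σ) : T.img (S.mixedCore T hσ) = S.mixedCore T hσ :=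
  img_iInf_iterate (S.wandering T hσ).isClosed (sigmaInvariant_wandering hσ) (img_wandering_le hσ)

lemma mixedCore_le_wandering (hσ : S.σ = T.σ) :
    S.mixedCore T hσ ≤ (S.wandering T hσ).toSubmodule :=
  iInf_le _ 0

lemma iterate_le_mixedPart (hσ : S.σ = T.σ) (n : ℕ) :
    S.img^[n] (S.mixedCore T hσ) ≤ S.mixedPart T hσ :=
  (le_iSup (fun n => S.img^[n] (S.mixedCore T hσ)) n).trans (Submodule.le_topologicalClosure _)

lemma mixedPart_le (hσ : S.σ = T.σ) (hM : IsClosed (M : Set H)) (h : S.img M ≤ M)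
    (hc : S.mixedCore T hσ ≤ M) : S.mixedPart T hσ ≤ M :=
  Submodule.topologicalClosure_minimal _ (iSup_le fun n => (S.img_mono.iterate n hc).trans
    (S.img_mono.antitone_iterate_of_map_le h (Nat.zero_le n))) hM

lemma img_mixedPart_le (hσ : S.σ = T.σ) : S.img (S.mixedPart T hσ) ≤ S.mixedPart T hσ := by
  rw [mixedPart, img_topologicalClosure, img_iSup]
  refine Submodule.topologicalClosure_mono (iSup_le fun n => ?_)
  rw [← Function.iterate_succ_apply' S.img n]
  exact le_iSup (fun n => S.img^[n] (S.mixedCore T hσ)) (n + 1)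

lemma img_mixedPart (hσ : S.σ = T.σ) (hc : Function.Commute S.img T.img) :
    T.img (S.mixedPart T hσ) = S.mixedPart T hσ := by
  rw [mixedPart, img_topologicalClosure, img_iSup]
  congr 2
  ext1 n
  rw [← (hc.iterate_left n).eq, img_mixedCore]

/-- The mixed part is orthogonal to everything that survives all iterates of `S`. -/
lemma iInf_iterate_le_mixedPart_orthogonal (hσ : S.σ = T.σ) :
    ⨅ n, S.img^[n] ⊤ ≤ (S.mixedPart T hσ)ᗮ := by
  rw [mixedPart, Submodule.orthogonal_closure, ← Submodule.iInf_orthogonal]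
  refine le_iInf fun n => (iInf_le _ (n + 1)).trans ?_
  rw [Function.iterate_succ_apply]
  refine (S.iterate_img_orthogonal (M := S.img ⊤) ?_ ?_ n)
  · rw [hσ, ← img_mixedCore]
    exact T.sigmaInvariant_img _
  · exact (Submodule.isOrtho_orthogonal_right _).mono_right
      ((mixedCore_le_wandering hσ).trans (wandering_le hσ))

lemma iInf_iterate_mixedPart (hσ : S.σ = T.σ) : ⨅ n, S.img^[n] (S.mixedPart T hσ) = ⊥ := by
  rw [eq_bot_iff, ← Submodule.inf_orthogonal_eq_bot (S.mixedPart T hσ)]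
  exact le_inf (iInf_le _ 0)
    ((iInf_mono fun n => S.img_mono.iterate n le_top).trans
      (iInf_iterate_le_mixedPart_orthogonal hσ))

lemma reduces_mixedPart_right (hσ : S.σ = T.σ) (hc : Function.Commute S.img T.img) :
    T.Reduces (S.mixedPart T hσ) :=
  reduces_of_img_eq (by rw [← img_mixedPart hσ hc]; exact T.sigmaInvariant_img _)
    (img_mixedPart hσ hc)

lemma reduces_mixedPart_left (hσ : S.σ = T.σ) (hc : Function.Commute S.img T.img) :
    S.Reduces (S.mixedPart T hσ) where
  isClosed := Submodule.isClosed_topologicalClosure _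
  map_σ := by rw [hσ]; exact (reduces_mixedPart_right hσ hc).map_σ
  map_T ξ h hh := img_mixedPart_le hσ (S.T_mem_img ξ hh)
  map_star ξ := by
    have hcl : IsClosed ((S.mixedPart T hσ).comap (star (S.T ξ)).toLinearMap : Set H) :=
      (Submodule.isClosed_topologicalClosure _).preimage (star (S.T ξ)).continuous
    refine Submodule.topologicalClosure_minimal (t := (S.mixedPart T hσ).comap
      (star (S.T ξ)).toLinearMap) _ (iSup_le fun n x hx => ?_) hcl
    change star (S.T ξ) x ∈ S.mixedPart T hσ
    have hσc : SigmaInvariant S.σ (S.mixedCore T hσ) := by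
      rw [hσ, ← img_mixedCore]
      exact T.sigmaInvariant_img _
    have hcc : IsClosed (S.mixedCore T hσ : Set H) := by
      rw [← img_mixedCore]
      exact T.isClosed_img _
    cases n with
    | zero =>
      -- the core is orthogonal to the range of `S̃`, hence annihilated by `S(ξ)*`
      have := S.mem_orthogonal_img_iff_star.1 (wandering_le hσ (mixedCore_le_wandering hσ hx)) ξ
      rw [Submodule.top_orthogonal_eq_bot, Submodule.mem_bot] at this
      rw [this]
      exact Submodule.zero_mem _
    | succ n =>
      rw [Function.iterate_succ_apply'] at hx
      exact iterate_le_mixedPart hσ n (star_T_mem (S.isClosed_iterate_img hcc n)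
        (sigmaInvariant_iterate_img hσc n) ξ hx)

/-- A reducing subspace where `T` is fully coisometric and `S` is induced is generated by a fixed
point of `T.img` in `S.wandering T`. -/
lemma le_mixedPart (hσ : S.σ = T.σ) (hc : Function.Commute S.img T.img) (hS : S.Reduces M)
    (hT : T.img M = M) (h0 : ⨅ n, S.img^[n] M = ⊥) : M ≤ S.mixedPart T hσ := by
  have hfix : T.img (M ⊓ (S.img M)ᗮ) = M ⊓ (S.img M)ᗮ := by
    have h1 : SigmaInvariant T.σ (S.img M) := hσ ▸ S.sigmaInvariant_img M
    rw [img_inf hS.isClosed (hσ ▸ hS.map_σ) (Submodule.isClosed_orthogonal _) h1.orthogonal,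
      img_orthogonal h1, ← hc.eq, hT, ← inf_assoc]
    congr 1
    conv_lhs => rw [← hT]
    rw [inf_eq_left.2 (T.img_mono le_top), hT]
  have hw : M ⊓ (S.img M)ᗮ ≤ (S.img ⊤)ᗮ := by
    have : CompleteSpace M := hS.isClosed.completeSpace_coe
    intro x hx
    refine S.mem_orthogonal_img.2 fun ξ h _ => ?_
    rw [← hS.inner_T_starProjection ξ h hx.1]
    exact S.mem_orthogonal_img.1 hx.2 ξ _ (M.starProjection_apply_mem h)
  have hcore : M ⊓ (S.img M)ᗮ ≤ S.mixedCore T hσ :=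
    le_iInf_iterate (le_wandering hσ (fun ξ h hh => hfix.le (T.T_mem_img ξ hh)) hw) hfix
  refine (le_closure_iSup_of_iInf_eq_bot hS.isClosed hS.map_σ hS.img_le h0).trans ?_
  exact Submodule.topologicalClosure_mono (iSup_mono fun n => S.img_mono.iterate n hcore)

lemma mixedCore_le_orthogonal (hσ : S.σ = T.σ) (hS : S.Reduces M) (hT : T.Reduces M)
    (h0 : ⨅ n, T.img^[n] ((S.wandering T hσ).toSubmodule ⊓ M) = ⊥) :
    S.mixedCore T hσ ≤ Mᗮ := by
  have : CompleteSpace M := hS.isClosed.completeSpace_coe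
  exact hT.starProjection_iInf (fun x hx => hS.starProjection_mem_wandering hσ hT hx) h0

end IsometricRep

/-! ### Orthogonal decompositions -/

lemma le_of_isOrtho_of_sup_eq_top {H : Type*} [NormedAddCommGroup H] [InnerProductSpace ℂ H]
    {B C M : Submodule ℂ H} (hBC : B ⟂ C) (h : B ⊔ C = ⊤)
    (hM : M ≤ Cᗮ) : M ≤ B := by
  intro x hx
  obtain ⟨b, hb, c, hc, rfl⟩ := Submodule.mem_sup.1 (h ▸ Submodule.mem_top : x ∈ B ⊔ C)
  have h0 := (Submodule.mem_orthogonal _ _).1 (hM hx) c hc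
  rw [inner_add_right, hBC.symm.inner_eq hc hb, zero_add, inner_self_eq_zero] at h0
  rwa [h0, add_zero]

namespace IsometricRep

variable {E F : Correspondence.{u, v} A} {S : IsometricRep H E} {T : IsometricRep H F}
  {M N : Submodule ℂ H}

/-- The summand of a Wold decomposition on which `T` is fully coisometric and `S` is induced is the
mixed part. Here `B`, `C` stand for the summands on which `S` is fully coisometric, and `W` for the
weakly bi-induced one. -/
lemma eq_mixedPart {B C W : Submodule ℂ H} (hσ : S.σ = T.σ) (hc : Function.Commute S.img T.img)
    (hS : S.Reduces M) (hT : T.img M = M) (h0 : ⨅ n, S.img^[n] M = ⊥)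
    (hB : S.img B = B) (hC : S.img C = C) (hWS : S.Reduces W) (hWT : T.Reduces W)
    (hW : ⨅ n, T.img^[n] ((S.wandering T hσ).toSubmodule ⊓ W) = ⊥)
    (hMB : M ⟂ B) (hMC : M ⟂ C) (hMW : M ⟂ W) (htop : M ⊔ (B ⊔ C ⊔ W) = ⊤) :
    M = S.mixedPart T hσ := by
  have hle : S.mixedCore T hσ ≤ S.mixedPart T hσ := iterate_le_mixedPart hσ 0
  have ho : ∀ B : Submodule ℂ H, S.img B = B → S.mixedCore T hσ ≤ Bᗮ := fun B hB =>
    hle.trans (Submodule.IsOrtho.symm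
      ((le_iInf_iterate le_top hB).trans (iInf_iterate_le_mixedPart_orthogonal hσ)))
  refine le_antisymm (le_mixedPart hσ hc hS hT h0) (mixedPart_le hσ hS.isClosed hS.img_le ?_)
  refine le_of_isOrtho_of_sup_eq_top ?_ htop ?_
  · simp only [Submodule.isOrtho_sup_right]
    exact ⟨⟨hMB, hMC⟩, hMW⟩
  · rw [← Submodule.inf_orthogonal, ← Submodule.inf_orthogonal]
    exact le_inf (le_inf (ho B hB) (ho C hC)) (mixedCore_le_orthogonal hσ hWS hWT hW)

end IsometricRep
end Wold
end

noncomputable section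
namespace Wold

variable {A : Type u} [NonUnitalCStarAlgebra A] [PartialOrder A] [StarOrderedRing A]
variable {H : Type w} [NormedAddCommGroup H] [InnerProductSpace ℂ H] [CompleteSpace H]

/-! ### Tensor products of representations -/

namespace IsometricRep

variable {E F : Correspondence.{u, v} A} {S : IsometricRep H E} {T : IsometricRep H F}
  {M N : Submodule ℂ H}

/-- Whether the operators of `S ⊗ T` map `h` into a closed subspace can be tested on simple
tensors. -/
lemma tensor_T_mem (P : E.TensorProduct F) (hσ : S.σ = T.σ) (hN : IsClosed (N : Set H)) {h : H}
    (hST : ∀ x y, S.T x (T.T y h) ∈ N) (z : P.obj) : (S.tensor T P hσ).T z h ∈ N := by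
  have hcl : IsClosed ((N.comap ((ContinuousLinearMap.apply ℂ H h) ∘L
      (tensorT S T P)).toLinearMap : Submodule ℂ P.obj) : Set P.obj) :=
    hN.preimage ((ContinuousLinearMap.apply ℂ H h) ∘L (tensorT S T P)).continuous
  have := Submodule.topologicalClosure_minimal (Submodule.span ℂ {z : P.obj | ∃ x y, P.tmul x y = z})
    (Submodule.span_le.2 ?_) hcl
  · rw [P.dense] at this
    exact this (Submodule.mem_top (x := z))
  · rintro _ ⟨x, y, rfl⟩
    change tensorT S T P (P.tmul x y) h ∈ N
    rw [tensorT_tmul P hσ]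
    exact hST x y

lemma img_tensor (P : E.TensorProduct F) (hσ : S.σ = T.σ) (M : Submodule ℂ H) :
    (S.tensor T P hσ).img M = S.img (T.img M) := by
  refine le_antisymm (img_le (S.isClosed_img _) fun z h hh => ?_)
    (img_le (isClosed_img _ _) fun x k hk => ?_)
  · exact tensor_T_mem P hσ (S.isClosed_img _)
      (fun x y => S.T_mem_img x (T.T_mem_img y hh)) z
  · refine map_img_le (isClosed_img _ _) (fun y h hh => ?_) k hk
    have := (S.tensor T P hσ).T_mem_img (P.tmul x y) hh
    change tensorT S T P (P.tmul x y) h ∈ _ at this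
    rwa [tensorT_tmul P hσ] at this

end IsometricRep

/-! ### Representations of product systems -/

namespace ProductSystem.IsometricRep

variable {𝔼 : ProductSystem.{u, v} A} {V : 𝔼.IsometricRep H} {M N : Submodule ℂ H}

lemma commute_img (V : 𝔼.IsometricRep H) : Function.Commute V.fst.img V.snd.img := by
  intro M
  rw [← Wold.IsometricRep.img_tensor 𝔼.prod₁₂ V.σ_eq,
    ← Wold.IsometricRep.img_tensor 𝔼.prod₂₁ V.σ_eq.symm]
  refine le_antisymm (Wold.IsometricRep.img_le (Wold.IsometricRep.isClosed_img _ _)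
    fun z h hh => ?_) (Wold.IsometricRep.img_le (Wold.IsometricRep.isClosed_img _ _)
    fun z h hh => ?_)
  · obtain ⟨z, rfl⟩ := 𝔼.t.toLinearEquiv.surjective z
    rw [← V.comm]
    exact Wold.IsometricRep.T_mem_img _ z hh
  · rw [V.comm]
    exact Wold.IsometricRep.T_mem_img _ _ hh

lemma img_prod (V : 𝔼.IsometricRep H) (M : Submodule ℂ H) :
    V.prod.img M = V.fst.img (V.snd.img M) :=
  Wold.IsometricRep.img_tensor 𝔼.prod₁₂ V.σ_eq M

lemma img_prod' (V : 𝔼.IsometricRep H) (M : Submodule ℂ H) :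
    V.prod.img M = V.snd.img (V.fst.img M) := by
  rw [img_prod, V.commute_img.eq]

lemma reduces_prod (h1 : V.fst.Reduces M) (h2 : V.snd.Reduces M) : V.prod.Reduces M :=
  .mk_of_orthogonal h1.isClosed h1.map_σ
    (fun z _ hh => Wold.IsometricRep.tensor_T_mem 𝔼.prod₁₂ V.σ_eq h1.isClosed
      (fun x y => h1.map_T x _ (h2.map_T y _ hh)) z)
    (fun z _ hh => Wold.IsometricRep.tensor_T_mem 𝔼.prod₁₂ V.σ_eq (Submodule.isClosed_orthogonal _)
      (fun x y => h1.map_T_orthogonal x (h2.map_T_orthogonal y hh)) z)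

namespace ReducingSubspace

/-- A subspace that reduces both `(σ, T⁽¹⁾)` and `(σ, T⁽²⁾)` as a reducing subspace. -/
def ofReduces (h1 : V.fst.Reduces M) (h2 : V.snd.Reduces M) : V.ReducingSubspace where
  toSubmodule := M
  isClosed := h1.isClosed
  map_σ := h1.map_σ
  map_fst := h1.map_T
  map_snd := h2.map_T
  map_σ_orthogonal := h1.orthogonal.map_σ
  map_fst_orthogonal := h1.orthogonal.map_T
  map_snd_orthogonal := h2.orthogonal.map_T

variable (R : V.ReducingSubspace)

lemma reduces_fst : V.fst.Reduces R.toSubmodule :=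
  .mk_of_orthogonal R.isClosed R.map_σ R.map_fst R.map_fst_orthogonal

lemma reduces_snd : V.snd.Reduces R.toSubmodule :=
  .mk_of_orthogonal R.isClosed (by rw [← V.σ_eq]; exact R.map_σ) R.map_snd R.map_snd_orthogonal

lemma map_subtype_restrict_prod_img (M : Submodule ℂ R.toSubmodule) :
    ((V.restrict R).prod.img M).map R.toSubmodule.subtype =
      V.prod.img (M.map R.toSubmodule.subtype) := by
  rw [img_prod, img_prod]
  exact (Wold.IsometricRep.map_subtype_restrict_img R.fst _).trans
    (congrArg _ (Wold.IsometricRep.map_subtype_restrict_img R.snd M))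

lemma map_subtype_K₂ : (V.restrict R).K₂.toSubmodule.map R.toSubmodule.subtype =
    V.K₂.toSubmodule ⊓ R.toSubmodule :=
  Wold.IsometricRep.map_subtype_wandering V.σ_eq.symm R.toSubmodule R.isClosed R.snd.map_σ R.map_σ
    R.map_snd R.map_fst R.reduces_snd _

lemma map_subtype_K₁ : (V.restrict R).K₁.toSubmodule.map R.toSubmodule.subtype =
    V.K₁.toSubmodule ⊓ R.toSubmodule :=
  Wold.IsometricRep.map_subtype_wandering V.σ_eq R.toSubmodule R.isClosed R.map_σ R.snd.map_σ
    R.map_fst R.map_snd R.reduces_fst _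

lemma isWeaklyBiInduced_restrict_iff : (V.restrict R).IsWeaklyBiInduced ↔
    ⨅ n, V.prod.img^[n] R.toSubmodule = ⊥ ∧
    ⨅ n, V.fst.img^[n] (V.K₂.toSubmodule ⊓ R.toSubmodule) = ⊥ ∧
    ⨅ n, V.snd.img^[n] (V.K₁.toSubmodule ⊓ R.toSubmodule) = ⊥ := by
  have e0 : (V.restrict R).prod.IsInduced ↔ ⨅ n, V.prod.img^[n] R.toSubmodule = ⊥ := by
    rw [Wold.IsometricRep.isInduced_iff,
      iInf_iterate_eq_bot_iff _ R.map_subtype_restrict_prod_img, Submodule.map_top,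
      Submodule.range_subtype]
  have e1 : ((V.restrict R).fst.restrict (V.restrict R).K₂).IsInduced ↔
      ⨅ n, V.fst.img^[n] (V.K₂.toSubmodule ⊓ R.toSubmodule) = ⊥ := by
    rw [Wold.IsometricRep.restrict_isInduced_iff, ← R.map_subtype_K₂]
    exact iInf_iterate_eq_bot_iff R.toSubmodule
      (Wold.IsometricRep.map_subtype_restrict_img R.fst) _
  have e2 : ((V.restrict R).snd.restrict (V.restrict R).K₁).IsInduced ↔
      ⨅ n, V.snd.img^[n] (V.K₁.toSubmodule ⊓ R.toSubmodule) = ⊥ := by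
    rw [Wold.IsometricRep.restrict_isInduced_iff, ← R.map_subtype_K₁]
    exact iInf_iterate_eq_bot_iff R.toSubmodule
      (Wold.IsometricRep.map_subtype_restrict_img R.snd) _
  rw [← e0, ← e1, ← e2]
  exact ⟨fun h => ⟨h.prod, h.fst, h.snd⟩, fun h => ⟨h.1, h.2.1, h.2.2⟩⟩

end ReducingSubspace

/-! ### The Wold decomposition -/

/-- The fully coisometric part of `(σ, T⁽¹⁾ ⊗ T⁽²⁾)`. -/
def coisometricPart (V : 𝔼.IsometricRep H) : Submodule ℂ H := ⨅ n, V.prod.img^[n] ⊤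

/-- The part where `T⁽¹⁾` is induced and `T⁽²⁾` is fully coisometric. -/
def inducedPart₁ (V : 𝔼.IsometricRep H) : Submodule ℂ H := V.fst.mixedPart V.snd V.σ_eq

/-- The part where `T⁽²⁾` is induced and `T⁽¹⁾` is fully coisometric. -/
def inducedPart₂ (V : 𝔼.IsometricRep H) : Submodule ℂ H := V.snd.mixedPart V.fst V.σ_eq.symm

variable (V)

lemma prod_img_coisometricPart : V.prod.img V.coisometricPart = V.coisometricPart :=
  Wold.IsometricRep.img_iInf_iterate isClosed_univ (SigmaInvariant.top _) le_top

lemma sigmaInvariant_coisometricPart : SigmaInvariant V.fst.σ V.coisometricPart := by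
  rw [← prod_img_coisometricPart]
  exact V.prod.sigmaInvariant_img _

lemma fst_img_coisometricPart : V.fst.img V.coisometricPart = V.coisometricPart := by
  have hle : ∀ M, V.prod.img M = M → M ≤ V.coisometricPart := fun M hM =>
    Wold.IsometricRep.le_iInf_iterate le_top hM
  have h1 : V.fst.img V.coisometricPart ≤ V.coisometricPart :=
    hle _ (by rw [img_prod, ← V.commute_img.eq, ← img_prod, prod_img_coisometricPart])
  have h2 : V.snd.img V.coisometricPart ≤ V.coisometricPart :=
    hle _ (by rw [img_prod', V.commute_img.eq, ← img_prod', prod_img_coisometricPart])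
  refine le_antisymm h1 ?_
  conv_lhs => rw [← prod_img_coisometricPart, img_prod]
  exact V.fst.img_mono h2

lemma snd_img_coisometricPart : V.snd.img V.coisometricPart = V.coisometricPart := by
  conv_lhs => rw [← fst_img_coisometricPart]
  rw [← img_prod', prod_img_coisometricPart]

variable {V} in
/-- `IsWoldDecomposition` in terms of the subspaces `img` of `H` itself. -/
lemma isWoldDecomposition_iff {H₀ H₁ H₂ Hwi : V.ReducingSubspace} :
    V.IsWoldDecomposition H₀ H₁ H₂ Hwi ↔
      ([H₀, H₁, H₂, Hwi].Pairwise fun M N => M.toSubmodule ⟂ N.toSubmodule) ∧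
      H₀.toSubmodule ⊔ H₁.toSubmodule ⊔ H₂.toSubmodule ⊔ Hwi.toSubmodule = ⊤ ∧
      V.fst.img H₀.toSubmodule = H₀.toSubmodule ∧ V.fst.img H₂.toSubmodule = H₂.toSubmodule ∧
      V.snd.img H₀.toSubmodule = H₀.toSubmodule ∧ V.snd.img H₁.toSubmodule = H₁.toSubmodule ∧
      ⨅ n, V.fst.img^[n] H₁.toSubmodule = ⊥ ∧ ⨅ n, V.snd.img^[n] H₂.toSubmodule = ⊥ ∧
      ⨅ n, V.prod.img^[n] Hwi.toSubmodule = ⊥ ∧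
      ⨅ n, V.fst.img^[n] (V.K₂.toSubmodule ⊓ Hwi.toSubmodule) = ⊥ ∧
      ⨅ n, V.snd.img^[n] (V.K₁.toSubmodule ⊓ Hwi.toSubmodule) = ⊥ := by
  have c1 : ∀ R : V.ReducingSubspace, (V.restrict R).fst.IsFullyCoisometric ↔
      V.fst.img R.toSubmodule = R.toSubmodule := fun R =>
    Wold.IsometricRep.restrict_isFullyCoisometric_iff R.fst
  have c2 : ∀ R : V.ReducingSubspace, (V.restrict R).snd.IsFullyCoisometric ↔
      V.snd.img R.toSubmodule = R.toSubmodule := fun R =>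
    Wold.IsometricRep.restrict_isFullyCoisometric_iff R.snd
  have i1 : ∀ R : V.ReducingSubspace, (V.restrict R).fst.IsInduced ↔
      ⨅ n, V.fst.img^[n] R.toSubmodule = ⊥ := fun R =>
    Wold.IsometricRep.restrict_isInduced_iff V.fst R.fst
  have i2 : ∀ R : V.ReducingSubspace, (V.restrict R).snd.IsInduced ↔
      ⨅ n, V.snd.img^[n] R.toSubmodule = ⊥ := fun R =>
    Wold.IsometricRep.restrict_isInduced_iff V.snd R.snd
  rw [← c1, ← c1, ← c2, ← c2, ← i1, ← i2, ← Hwi.isWeaklyBiInduced_restrict_iff]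
  exact ⟨fun ⟨a, b, c, d, e, f, g, h, i⟩ => ⟨a, b, c, d, e, f, g, h, i⟩,
    fun ⟨a, b, c, d, e, f, g, h, i⟩ => ⟨a, b, c, d, e, f, g, h, i⟩⟩

/-- The summands of a Wold decomposition are determined by the representation. -/
lemma IsWoldDecomposition.eq {V : 𝔼.IsometricRep H} {H₀ H₁ H₂ Hwi : V.ReducingSubspace}
    (h : V.IsWoldDecomposition H₀ H₁ H₂ Hwi) :
    H₀.toSubmodule = V.coisometricPart ∧ H₁.toSubmodule = V.inducedPart₁ ∧
      H₂.toSubmodule = V.inducedPart₂ ∧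
      Hwi.toSubmodule = (V.coisometricPart ⊔ V.inducedPart₁ ⊔ V.inducedPart₂)ᗮ := by
  obtain ⟨ho, htop, f0, f2, s0, s1, i1, i2, w, w1, w2⟩ := isWoldDecomposition_iff.1 h
  simp only [List.pairwise_cons, List.mem_cons, List.not_mem_nil, or_false, forall_eq_or_imp,
    forall_eq, IsEmpty.forall_iff, implies_true, and_true, List.Pairwise.nil] at ho
  obtain ⟨⟨o01, o02, o0w⟩, ⟨o12, o1w⟩, o2w⟩ := ho
  have e1 : H₁.toSubmodule = V.inducedPart₁ :=
    Wold.IsometricRep.eq_mixedPart V.σ_eq V.commute_img H₁.reduces_fst s1 i1 f0 f2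
      Hwi.reduces_fst Hwi.reduces_snd w2 o01.symm o12 o1w (by rw [← htop]; ac_rfl)
  have e2 : H₂.toSubmodule = V.inducedPart₂ :=
    Wold.IsometricRep.eq_mixedPart V.σ_eq.symm V.commute_img.symm H₂.reduces_snd f2 i2 s0 s1
      Hwi.reduces_snd Hwi.reduces_fst w1 o02.symm o12.symm o2w (by rw [← htop]; ac_rfl)
  have e0 : H₀.toSubmodule = V.coisometricPart := by
    refine le_antisymm (Wold.IsometricRep.le_iInf_iterate le_top (by rw [img_prod, s0, f0])) ?_
    refine le_of_isOrtho_of_sup_eq_top (C := H₁.toSubmodule ⊔ H₂.toSubmodule ⊔ Hwi.toSubmodule)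
      ?_ (by rw [← htop]; ac_rfl) ?_
    · simp only [Submodule.isOrtho_sup_right]
      exact ⟨⟨o01, o02⟩, o0w⟩
    · rw [← Submodule.inf_orthogonal, ← Submodule.inf_orthogonal, e1, e2]
      refine le_inf (le_inf ?_ ?_) ?_
      · exact (Wold.IsometricRep.le_iInf_iterate le_top V.fst_img_coisometricPart).trans
          (Wold.IsometricRep.iInf_iterate_le_mixedPart_orthogonal _)
      · exact (Wold.IsometricRep.le_iInf_iterate le_top V.snd_img_coisometricPart).trans
          (Wold.IsometricRep.iInf_iterate_le_mixedPart_orthogonal _)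
      · exact (reduces_prod Hwi.reduces_fst Hwi.reduces_snd).starProjection_iInf
          (fun x _ => Submodule.starProjection_apply_mem _ x) w
  refine ⟨e0, e1, e2, ?_⟩
  rw [← e0, ← e1, ← e2]
  have ho' : Hwi.toSubmodule ⟂ H₀.toSubmodule ⊔ H₁.toSubmodule ⊔ H₂.toSubmodule := by
    simp only [Submodule.isOrtho_sup_right]
    exact ⟨⟨o0w.symm, o1w.symm⟩, o2w.symm⟩
  exact le_antisymm ho' (le_of_isOrtho_of_sup_eq_top ho' (by rw [sup_comm, htop]) le_rfl)

lemma exists_isWoldDecomposition :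
    ∃ H₀ H₁ H₂ Hwi : V.ReducingSubspace, V.IsWoldDecomposition H₀ H₁ H₂ Hwi := by
  have r0 : V.fst.Reduces V.coisometricPart :=
    Wold.IsometricRep.reduces_of_img_eq V.sigmaInvariant_coisometricPart V.fst_img_coisometricPart
  have r0' : V.snd.Reduces V.coisometricPart :=
    Wold.IsometricRep.reduces_of_img_eq (V.σ_eq ▸ V.sigmaInvariant_coisometricPart)
      V.snd_img_coisometricPart
  have r1 : V.fst.Reduces V.inducedPart₁ :=
    Wold.IsometricRep.reduces_mixedPart_left V.σ_eq V.commute_img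
  have r1' : V.snd.Reduces V.inducedPart₁ :=
    Wold.IsometricRep.reduces_mixedPart_right V.σ_eq V.commute_img
  have r2 : V.fst.Reduces V.inducedPart₂ :=
    Wold.IsometricRep.reduces_mixedPart_right V.σ_eq.symm V.commute_img.symm
  have r2' : V.snd.Reduces V.inducedPart₂ :=
    Wold.IsometricRep.reduces_mixedPart_left V.σ_eq.symm V.commute_img.symm
  have s1 : V.snd.img V.inducedPart₁ = V.inducedPart₁ :=
    Wold.IsometricRep.img_mixedPart V.σ_eq V.commute_img
  have f2 : V.fst.img V.inducedPart₂ = V.inducedPart₂ :=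
    Wold.IsometricRep.img_mixedPart V.σ_eq.symm V.commute_img.symm
  have o1 : ∀ M, V.fst.img M = M → M ⟂ V.inducedPart₁ := fun M hM =>
    (Wold.IsometricRep.le_iInf_iterate le_top hM).trans
      (Wold.IsometricRep.iInf_iterate_le_mixedPart_orthogonal _)
  have o2 : ∀ M, V.snd.img M = M → M ⟂ V.inducedPart₂ := fun M hM =>
    (Wold.IsometricRep.le_iInf_iterate le_top hM).trans
      (Wold.IsometricRep.iInf_iterate_le_mixedPart_orthogonal _)
  have o01 := o1 _ V.fst_img_coisometricPart
  have o02 := o2 _ V.snd_img_coisometricPart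
  have o12 := o2 _ s1
  set W : Submodule ℂ H := V.coisometricPartᗮ ⊓ V.inducedPart₁ᗮ ⊓ V.inducedPart₂ᗮ with hW
  have w0 : W ≤ V.coisometricPartᗮ := inf_le_left.trans inf_le_left
  have w1 : W ≤ V.inducedPart₁ᗮ := inf_le_left.trans inf_le_right
  have w2 : W ≤ V.inducedPart₂ᗮ := inf_le_right
  refine ⟨.ofReduces r0 r0', .ofReduces r1 r1', .ofReduces r2 r2',
    .ofReduces (M := W) ((r0.orthogonal.inf r1.orthogonal).inf r2.orthogonal)
      ((r0'.orthogonal.inf r1'.orthogonal).inf r2'.orthogonal),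
    isWoldDecomposition_iff.2 ⟨?_, ?_, V.fst_img_coisometricPart, f2, V.snd_img_coisometricPart,
      s1, Wold.IsometricRep.iInf_iterate_mixedPart _, Wold.IsometricRep.iInf_iterate_mixedPart _,
      ?_, ?_, ?_⟩⟩
  · simp only [List.pairwise_cons, List.mem_cons, List.not_mem_nil, or_false, forall_eq_or_imp,
      forall_eq, IsEmpty.forall_iff, implies_true, and_true, List.Pairwise.nil]
    exact ⟨⟨o01, o02, Submodule.IsOrtho.symm w0⟩, ⟨o12, Submodule.IsOrtho.symm w1⟩,
      Submodule.IsOrtho.symm w2⟩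
  · change V.coisometricPart ⊔ V.inducedPart₁ ⊔ V.inducedPart₂ ⊔ W = ⊤
    have : CompleteSpace V.coisometricPart := r0.isClosed.completeSpace_coe
    have : CompleteSpace V.inducedPart₁ := r1.isClosed.completeSpace_coe
    have : CompleteSpace V.inducedPart₂ := r2.isClosed.completeSpace_coe
    have s01 := Submodule.sup_orthogonal_inf_of_hasOrthogonalProjection
      (Submodule.IsOrtho.symm o01)
    have s02 := Submodule.sup_orthogonal_inf_of_hasOrthogonalProjection
      (K₂ := V.coisometricPartᗮ ⊓ V.inducedPart₁ᗮ)
      (le_inf (Submodule.IsOrtho.symm o02) (Submodule.IsOrtho.symm o12))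
    rw [inf_comm] at s01 s02
    rw [sup_assoc, s02, sup_assoc, s01, Submodule.sup_orthogonal_of_hasOrthogonalProjection]
  -- each of the three remaining parts lies both in `W` and in one of the first three summands
  · rw [eq_bot_iff, ← Submodule.inf_orthogonal_eq_bot V.coisometricPart]
    exact le_inf (iInf_mono fun n => V.prod.img_mono.iterate n le_top)
      ((iInf_le _ 0).trans w0)
  · rw [eq_bot_iff, ← Submodule.inf_orthogonal_eq_bot V.inducedPart₂]
    exact le_inf ((iInf_mono fun n => V.fst.img_mono.iterate n inf_le_left).trans
      (Wold.IsometricRep.iterate_le_mixedPart V.σ_eq.symm 0))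
      ((iInf_le _ 0).trans (inf_le_right.trans w2))
  · rw [eq_bot_iff, ← Submodule.inf_orthogonal_eq_bot V.inducedPart₁]
    exact le_inf ((iInf_mono fun n => V.snd.img_mono.iterate n inf_le_left).trans
      (Wold.IsometricRep.iterate_le_mixedPart V.σ_eq 0))
      ((iInf_le _ 0).trans (inf_le_right.trans w1))

end ProductSystem.IsometricRep
end Wold
end

theorem theorem3p4 {A : Type u} [NonUnitalCStarAlgebra A] [PartialOrder A] [StarOrderedRing A]
    (𝔼 : Wold.ProductSystem.{u, v} A)
    {H : Type w} [NormedAddCommGroup H] [InnerProductSpace ℂ H] [CompleteSpace H]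
    (V : 𝔼.IsometricRep H) :
    ∃ H₀ H₁ H₂ Hwi : V.ReducingSubspace,
      V.IsWoldDecomposition H₀ H₁ H₂ Hwi ∧
      ∀ H₀' H₁' H₂' Hwi' : V.ReducingSubspace, V.IsWoldDecomposition H₀' H₁' H₂' Hwi' →
        H₀' = H₀ ∧ H₁' = H₁ ∧ H₂' = H₂ ∧ Hwi' = Hwi := by
  obtain ⟨H₀, H₁, H₂, Hwi, h⟩ := V.exists_isWoldDecomposition
  refine ⟨H₀, H₁, H₂, Hwi, h, fun H₀' H₁' H₂' Hwi' h' => ?_⟩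
  obtain ⟨e0, e1, e2, e3⟩ := h.eq
  obtain ⟨e0', e1', e2', e3'⟩ := h'.eq
  exact ⟨Wold.ProductSystem.IsometricRep.ReducingSubspace.ext (e0'.trans e0.symm),
    Wold.ProductSystem.IsometricRep.ReducingSubspace.ext (e1'.trans e1.symm),
    Wold.ProductSystem.IsometricRep.ReducingSubspace.ext (e2'.trans e2.symm),
    Wold.ProductSystem.IsometricRep.ReducingSubspace.ext (e3'.trans e3.symm)⟩
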